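/- Let $\mathcal L(\mathbb Z^2)$ be the square lattice: the graph with vertex set $\mathbb Z^2$ in which two points are adjacent when they are at Euclidean distance $1$. A simple closed loop $\alpha$ in $\mathcal L(\mathbb Z^2)$ is a cyclic sequence of more than two distinct vertices, each adjacent to the next (and the last adjacent to the first); its interior is the union of the bounded components of the complement in $\mathbb R^2$ of the closed polygonal curve it traces. A finite connected subgraph $G$ of $\mathcal L(\mathbb Z^2)$ is a simple grid graph, bounded by $\alpha$, if it consists of all of the vertices and edges of $\mathcal L(\mathbb Z^2)$ that are on or interior to $\alpha$. In this case $\partial G$ denotes the set of vertices of $\alpha$, and $\mathrm{Area}(G)$ the number of unit-square faces of $\mathcal L(\mathbb Z^2)$ in the interior of $\alpha$. The top-left boundary $\hat\partial G$ is the set of those $v\in V(G)$ for which the $1$-by-$1$ square (its four vertices and four edges) with bottom-right corner $v$ is not a subgraph of $G$. For a finite graph $H$, let $\tau(H)$ be the number of ways to choose one spanning tree from each connected component of $H$ (so $\tau(H)=1$ for the empty graph). Order $V(G)$ by rows from top to bottom, and within each row from left to right. For $v\in V(G)$ let $H'_v$ (respectively $H_v$) be the subgraph of $G$ induced by all vertices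 prior to $v$ (respectively prior to and including $v$), and let $m_v=\tau(H_v)/\tau(H'_v)$. If $G$ is a simple grid graph bounded by $\alpha$, then $m_v\le 4$ for every $v\in V(G)$ with $v\notin\hat\partial G$, and $m_v=1$ for every $v\in\hat\partial G$. Moreover $$\tau(G)\le 4^m,\qquad\text{where } m=\mathrm{Area}(G)=|V(G)|-\tfrac12|\partial G|-1=|V(G)|-|\hat\partial G|.$$ -/

import Mathlib

namespace GridGraph

/-- The square lattice `ℒ(ℤ²)`: vertex set `ℤ²`, with rook-adjacent points joined by an edge. -/
def squareLattice : SimpleGraph (ℤ × ℤ) where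
  Adj p q := (p.1 = q.1 ∧ |p.2 - q.2| = 1) ∨ (p.2 = q.2 ∧ |p.1 - q.1| = 1)
  symm := by
    refine ⟨fun p q h => ?_⟩
    rcases h with ⟨h1, h2⟩ | ⟨h1, h2⟩
    · exact Or.inl ⟨h1.symm, by rwa [abs_sub_comm]⟩
    · exact Or.inr ⟨h1.symm, by rwa [abs_sub_comm]⟩
  loopless := ⟨fun p h => by simp at h⟩

/-- A grid graph is a finite connected subgraph of the square lattice. -/
def IsGridGraph (G : squareLattice.Subgraph) : Prop :=
  G.verts.Finite ∧ G.Connected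

/-- A lattice point viewed as a point of the plane. -/
def toPlane (p : ℤ × ℤ) : ℝ × ℝ := ((p.1 : ℝ), (p.2 : ℝ))

/-- A simple closed loop in the square lattice: a cyclic sequence of more than two distinct
vertices, each one adjacent to the next (the last one being adjacent to the first). -/
structure SimpleClosedLoop where
  length : ℕ
  two_lt_length : 2 < length
  vertex : ZMod length → ℤ × ℤ
  injective : Function.Injective vertex
  adj : ∀ i, squareLattice.Adj (vertex i) (vertex (i + 1))

namespace SimpleClosedLoop

/-- The vertices of the loop. -/
def vertices (α : SimpleClosedLoop) : Set (ℤ × ℤ) := Set.range α.vertex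

/-- The closed polygonal curve in `ℝ²` traced by the loop. -/
def trace (α : SimpleClosedLoop) : Set (ℝ × ℝ) :=
  ⋃ i, segment ℝ (toPlane (α.vertex i)) (toPlane (α.vertex (i + 1)))

/-- The interior of the loop: the points of `ℝ²` off the curve whose connected component in the
complement of the curve is bounded. -/
def interior (α : SimpleClosedLoop) : Set (ℝ × ℝ) :=
  {x | x ∈ α.traceᶜ ∧ Bornology.IsBounded (connectedComponentIn α.traceᶜ x)}

/-- The subgraph of the square lattice comprised of all of the vertices and edges that are on and
interior to the loop. -/
def subgraph (α : SimpleClosedLoop) : squareLattice.Subgraph where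
  verts := {p | toPlane p ∈ α.trace ∪ α.interior}
  Adj p q := squareLattice.Adj p q ∧ segment ℝ (toPlane p) (toPlane q) ⊆ α.trace ∪ α.interior
  adj_sub h := h.1
  edge_vert h := h.2 (left_mem_segment ℝ _ _)
  symm := ⟨fun p q h => ⟨h.1.symm, by rw [segment_symm]; exact h.2⟩⟩

/-- The area enclosed by the loop: the number of faces (open unit squares) of the square lattice
that lie in the interior of the loop. -/
noncomputable def area (α : SimpleClosedLoop) : ℕ :=
  Set.ncard {p : ℤ × ℤ |
    Set.Ioo (p.1 : ℝ) (p.1 + 1) ×ˢ Set.Ioo (p.2 : ℝ) (p.2 + 1) ⊆ α.interior}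

end SimpleClosedLoop

/-- The vertices and edges of the `1`-by-`1` square whose bottom-right corner is `v`. -/
def box (v : ℤ × ℤ) : squareLattice.Subgraph :=
  (⊤ : squareLattice.Subgraph).induce
    {v, (v.1, v.2 + 1), (v.1 - 1, v.2 + 1), (v.1 - 1, v.2)}

/-- The top-left boundary of `G`: the vertices `v` of `G` such that the unit square whose
bottom-right corner is `v` is not a subgraph of `G`. -/
def topLeftBoundary (G : squareLattice.Subgraph) : Set (ℤ × ℤ) :=
  {v ∈ G.verts | ¬ box v ≤ G}

/-- `𝒯(H)`: the ways to choose one spanning tree from each connected component of `H`. Such a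
choice is encoded by the graph `T` on the vertices of `H` that is the union of the chosen trees. -/
def spanningForests {V : Type*} (H : SimpleGraph V) : Set (SimpleGraph V) :=
  {T | T ≤ H ∧ ∀ C : H.ConnectedComponent, (T.induce C.supp).IsTree}

/-- `τ(H)`, the number of elements of `𝒯(H)`. When `H` is connected this is its number of spanning
trees. -/
noncomputable def tau {V : Type*} (H : SimpleGraph V) : ℕ := (spanningForests H).ncard

/-- `p` strictly precedes `q` in the words-on-a-page order: rows from top to bottom, and each row
from left to right. -/
def Precedes (p q : ℤ × ℤ) : Prop := q.2 < p.2 ∨ (p.2 = q.2 ∧ p.1 < q.1)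

/-- `H'_v`: the subgraph of `G` induced by all vertices of `G` prior to `v`. -/
def priorGraph (G : squareLattice.Subgraph) (v : ℤ × ℤ) : squareLattice.Subgraph :=
  G.induce {w ∈ G.verts | Precedes w v}

/-- `H_v`: the subgraph of `G` induced by all vertices of `G` prior to and including `v`. -/
def uptoGraph (G : squareLattice.Subgraph) (v : ℤ × ℤ) : squareLattice.Subgraph :=
  G.induce {w ∈ G.verts | Precedes w v ∨ w = v}

/-- The multiplier `m_v = τ(H_v) / τ(H'_v)` of a vertex `v` of `G`. If `v` is the first vertex of
`G`, then both counts are `1` (the empty graph has exactly one, empty, choice), so that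
`m_v = 1`. -/
noncomputable def multiplier (G : squareLattice.Subgraph) (v : ℤ × ℤ) : ℝ :=
  (tau (uptoGraph G v).coe : ℝ) / (tau (priorGraph G v).coe : ℝ)

end GridGraph

/-!
Add the vertices of `G` in the page order. The only edges gained with `v` join it to its left and
upper neighbours. The first of them is pendant and does not change the number of spanning forests.
If both are present and the box at `v` lies in `G`, the second one closes a unit square. Every
spanning forest containing it then comes from an old one by exchanging it for one of the other
three sides of the square, so the count grows by a factor of at most `1 + 3 = 4`.

If `v` is on the top-left boundary, the two neighbours are not yet connected. Indeed, a path between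
them through earlier vertices would close up at `v` to a walk that winds once around the face to the
left of `v` modulo `2`. The faces with odd winding number that are not interior to `α` would form a
finite set of faces bounded by edges of `α` alone, and such faces are interior to `α`. Hence the
face to the left of `v` is interior, and the box at `v` lies in `G`. So the second edge is a bridge.

The same argument shows that deleting the bottom edge of every interior face leaves a spanning tree
of `G`. Counting its edges, and the sides of the interior faces, gives the formula for the area.
-/

namespace GridGraph

open SimpleGraph

open scoped symmDiff

/-! ### Spanning forests -/

section SpanningForest

variable {V W : Type*} {H S T : SimpleGraph V} {x y a b : V}

theorem reachable_of_forall_adj (h : ∀ ⦃a b⦄, H.Adj a b → T.Reachable a b)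
    (hab : H.Reachable a b) : T.Reachable a b := by
  obtain ⟨p⟩ := hab
  induction p with
  | nil => exact .rfl
  | cons hadj _ ih => exact (h hadj).trans ih

theorem not_isAcyclic_induce {c : H.Walk a a} (hc : c.IsCycle) {s : Set V}
    (hs : ∀ w ∈ c.support, w ∈ s) : ¬ (H.induce s).IsAcyclic := fun h =>
  h (c.induce s hs) <| (Walk.isCycle_map_iff_of_injective
    (f := (Embedding.induce s).toHom) Subtype.val_injective).1 <| by rwa [c.map_induce hs]

theorem mem_spanningForests_iff :
    T ∈ spanningForests H ↔ T ≤ H ∧ T.IsAcyclic ∧ T.Reachable = H.Reachable := by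
  classical
  constructor
  · rintro ⟨hle, hT⟩
    refine ⟨hle, fun v c hc => ?_, ?_⟩
    · refine not_isAcyclic_induce hc (fun w hw => ?_) (hT (H.connectedComponentMk v)).isAcyclic
      exact ConnectedComponent.eq.2 ((c.takeUntil w hw).reachable.mono hle).symm
    · ext a b
      refine ⟨fun h => h.mono hle, fun h => ?_⟩
      exact ((hT (H.connectedComponentMk a)).connected ⟨a, rfl⟩
        ⟨b, ConnectedComponent.eq.2 h.symm⟩).map (Embedding.induce _).toHom
  · rintro ⟨hle, hT, hreach⟩
    refine ⟨hle, fun C => ?_⟩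
    induction C using ConnectedComponent.ind with | h v => ?_
    have hsupp : (H.connectedComponentMk v).supp = (T.connectedComponentMk v).supp := by
      ext w
      simp only [ConnectedComponent.mem_supp_iff, ConnectedComponent.eq, hreach]
    rw [hsupp]
    exact hT.isTree_connectedComponent _

theorem mem_spanningForests_iff_maximal :
    T ∈ spanningForests H ↔ Maximal (fun F => F ≤ H ∧ F.IsAcyclic) T := by
  rw [mem_spanningForests_iff]
  refine ⟨fun ⟨hle, hT, h⟩ => (maximal_isAcyclic_iff_reachable_eq hle hT).2 h, fun h => ?_⟩
  exact ⟨h.prop.1, h.prop.2, (maximal_isAcyclic_iff_reachable_eq h.prop.1 h.prop.2).1 h⟩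

theorem finite_spanningForests (hH : H.edgeSet.Finite) : (spanningForests H).Finite := by
  refine .of_finite_image (f := edgeSet) (hH.finite_subsets.subset ?_) edgeSet_injective.injOn
  rintro _ ⟨T, hT, rfl⟩
  exact edgeSet_mono hT.1

theorem finite_edgeSet_spanningCoe {G : H.Subgraph} (hG : G.verts.Finite) :
    G.spanningCoe.edgeSet.Finite := by
  refine ((hG.prod hG).image fun p => s(p.1, p.2)).subset fun e => ?_
  induction e with | _ p q => ?_
  exact fun (h : G.Adj p q) => ⟨(p, q), ⟨h.fst_mem, h.snd_mem⟩, rfl⟩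

theorem tau_pos (hH : H.edgeSet.Finite) : 0 < tau H := by
  obtain ⟨F, hF⟩ := exists_isAcyclic_reachable_eq_le (G := H)
  exact (Set.ncard_pos (finite_spanningForests hH)).2 ⟨F, mem_spanningForests_iff.2 hF⟩

theorem tau_bot : tau (⊥ : SimpleGraph V) = 1 :=
  Set.ncard_eq_one.2 ⟨⊥, Set.eq_singleton_iff_unique_mem.2
    ⟨mem_spanningForests_iff.2 ⟨le_rfl, isAcyclic_bot, rfl⟩, fun _ hT => le_bot_iff.1 hT.1⟩⟩

theorem map_comap_eq_of_le_map {f : V ↪ W} {F : SimpleGraph W} (hF : F ≤ H.map f) :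
    (F.comap f).map f = F := by
  refine le_antisymm (map_comap_le f F) fun a b hab => ?_
  obtain ⟨-, u, w, -, rfl, rfl⟩ := hF hab
  exact ⟨hab.ne, u, w, hab, rfl, rfl⟩

theorem isAcyclic_map_iff (f : V ↪ W) : (H.map f).IsAcyclic ↔ H.IsAcyclic := by
  refine ⟨.of_map f, fun h v c hc => not_isAcyclic_induce hc (s := Set.range f) (fun w hw => ?_)
    ((Embedding.map f H).isoInduceRange.isAcyclic_iff.1 h)⟩
  obtain ⟨-, -, u, -, -, rfl, -⟩ := mem_support_of_mem_walk_support c hc.not_nil hw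
  exact Set.mem_range_self u

theorem spanningForests_map (f : V ↪ W) (H : SimpleGraph V) :
    spanningForests (H.map f) = SimpleGraph.map f '' spanningForests H := by
  have hacyclic : ∀ F : SimpleGraph W, (F ≤ H.map f ∧ F.IsAcyclic) ↔
      ∃ T, (T ≤ H ∧ T.IsAcyclic) ∧ T.map f = F := by
    refine fun F => ⟨fun ⟨hle, hF⟩ => ⟨F.comap f, ⟨?_, hF.of_comap f⟩,
      map_comap_eq_of_le_map hle⟩, ?_⟩
    · simpa only [comap_map_eq] using comap_monotone f hle
    · rintro ⟨T, ⟨hle, hT⟩, rfl⟩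
      exact ⟨map_monotone f hle, (isAcyclic_map_iff f).2 hT⟩
  have h := image_monotone_setOfPred_maximal (P := fun T => T ≤ H ∧ T.IsAcyclic)
    (f := SimpleGraph.map f) fun T T' _ _ => by rw [map_le_iff_le_comap, comap_map_eq]
  simp only [← hacyclic, ← mem_spanningForests_iff_maximal] at h
  exact h.symm

theorem tau_map (f : V ↪ W) (H : SimpleGraph V) : tau (H.map f) = tau H := by
  rw [tau, spanningForests_map, Set.ncard_image_of_injective _ (map_injective f), tau]

theorem tau_coe (G : H.Subgraph) : tau G.coe = tau G.spanningCoe := by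
  rw [← Subgraph.spanningCoe_coe, tau_map]

theorem ncard_edgeSet_add_one_of_mem_spanningForests {G : H.Subgraph} (hG : G.Connected)
    (hfin : G.verts.Finite) (hT : T ∈ spanningForests G.spanningCoe) :
    T.edgeSet.ncard + 1 = G.verts.ncard := by
  have : Finite G.verts := hfin
  rw [← Subgraph.spanningCoe_coe, spanningForests_map] at hT
  obtain ⟨F, hF, rfl⟩ := hT
  obtain ⟨-, hacyclic, hreach⟩ := mem_spanningForests_iff.1 hF
  have hconn : F.Connected := by
    rw [connected_iff, Preconnected, hreach]
    exact (connected_iff _).1 hG.coe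
  rw [edgeSet_map, Set.ncard_image_of_injective _ (Function.Embedding.injective _)]
  exact (isTree_iff_connected_and_card.1 ⟨hconn, hacyclic⟩).2

theorem adj_of_mem_spanningForests_sup_edge (hT : T ∈ spanningForests (H ⊔ edge x y))
    (hxy : ¬ H.Reachable x y) : T.Adj x y := by
  by_contra hadj
  obtain ⟨hle, -, hreach⟩ := mem_spanningForests_iff.1 hT
  have hne : x ≠ y := fun h => hxy (h ▸ .rfl)
  have hxyT : T.Reachable x y :=
    hreach ▸ Adj.reachable (.inr ((edge_adj ..).2 ⟨.inl ⟨rfl, rfl⟩, hne⟩))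
  exact hxy (hxyT.mono (((disjoint_edge _).2 hadj).left_le_of_le_sup_right hle))

theorem spanningForests_sup_edge_of_not_reachable (hxy : ¬ H.Reachable x y) :
    spanningForests (H ⊔ edge x y) = (· ⊔ edge x y) '' spanningForests H := by
  have hdisj : ∀ {F}, F ≤ H → Disjoint F (edge x y) := fun hle =>
    (disjoint_edge _).2 fun h => hxy (hle h).reachable
  have hacyclic : ∀ {F}, F ≤ H → F.IsAcyclic → (F ⊔ edge x y).IsAcyclic := fun hle hF =>
    hF.sup_edge_of_not_reachable fun h => hxy (h.mono hle)
  refine Set.Subset.antisymm (fun T hT => ?_) (Set.image_subset_iff.2 fun T hT => ?_)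
  · have hedge : edge x y ≤ T :=
      (edge_le_iff _).2 (.inr (adj_of_mem_spanningForests_sup_edge hT hxy))
    rw [mem_spanningForests_iff_maximal] at hT
    refine ⟨T \ edge x y, mem_spanningForests_iff_maximal.2
      ⟨⟨sdiff_le_iff'.2 hT.prop.1, hT.prop.2.anti sdiff_le⟩, fun F hF hle => ?_⟩,
      sdiff_sup_cancel hedge⟩
    have hFT : F ⊔ edge x y ≤ T :=
      hT.le_of_ge ⟨sup_le_sup_right hF.1 _, hacyclic hF.1 hF.2⟩ (sdiff_le_iff'.1 hle)
    exact le_sdiff.2 ⟨le_sup_left.trans hFT, hdisj hF.1⟩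
  · rw [mem_spanningForests_iff_maximal] at hT
    refine mem_spanningForests_iff_maximal.2
      ⟨⟨sup_le_sup_right hT.prop.1 _, hacyclic hT.prop.1 hT.prop.2⟩, fun F hF hle => ?_⟩
    refine sdiff_le_iff'.1 (hT.le_of_ge ⟨sdiff_le_iff'.2 hF.1, hF.2.anti sdiff_le⟩ ?_)
    exact le_sdiff.2 ⟨le_sup_left.trans hle, hdisj hT.prop.1⟩

theorem tau_sup_edge_of_not_reachable (hxy : ¬ H.Reachable x y) :
    tau (H ⊔ edge x y) = tau H := by
  have hcancel : ∀ F ∈ spanningForests H, (F ⊔ edge x y) \ edge x y = F := fun F hF =>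
    ((disjoint_edge _).2 fun h => hxy (hF.1 h).reachable).sup_sdiff_cancel_right
  rw [tau, spanningForests_sup_edge_of_not_reachable hxy, Set.InjOn.ncard_image, tau]
  exact Set.LeftInvOn.injOn (f₁' := (· \ edge x y)) hcancel

theorem tau_sup_inf_edge {K : SimpleGraph V} (h : K.Adj x y → ¬ H.Reachable x y) :
    tau (H ⊔ K ⊓ edge x y) = tau H := by
  by_cases hxy : K.Adj x y
  · rw [inf_eq_right.2 ((edge_le_iff _).2 (.inr hxy)), tau_sup_edge_of_not_reachable (h hxy)]
  · rw [((disjoint_edge _).2 hxy).eq_bot, sup_bot_eq]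

theorem reachable_left_or_right_of_sup_edge (h : (S ⊔ edge x y).Reachable x b) :
    S.Reachable x b ∨ S.Reachable y b := by
  obtain ⟨p⟩ := h
  by_contra hb
  obtain ⟨d, -, hd, hd'⟩ :=
    p.exists_boundary_dart {c | S.Reachable x c ∨ S.Reachable y c} (.inl .rfl) hb
  rcases d.adj with h | h
  · exact hd' (hd.imp (·.trans h.reachable) (·.trans h.reachable))
  · rcases (edge_adj ..).1 h with ⟨⟨-, hsnd⟩ | ⟨-, hsnd⟩, -⟩
    exacts [hd' (.inr (by rw [hsnd])), hd' (.inl (by rw [hsnd]))]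

theorem exists_exchange (hT : T ∈ spanningForests (H ⊔ edge x y)) (hxy : T.Adj x y)
    (p : H.Walk x y) : ∃ d ∈ p.darts, ∃ F ∈ spanningForests H,
      F \ edge d.fst d.snd ⊔ edge x y = T := by
  obtain ⟨hle, hacyclic, hreach⟩ := mem_spanningForests_iff.1 hT
  set S := T \ edge x y with hS
  have hST : S ⊔ edge x y = T := sdiff_sup_cancel ((edge_le_iff _).2 (.inr hxy))
  have hbridge : ¬ S.Reachable x y := isAcyclic_iff_forall_adj_isBridge.1 hacyclic hxy
  obtain ⟨d, hd, hfst, hsnd⟩ := p.exists_boundary_dart {a | S.Reachable x a} .rfl hbridge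
  rw [Set.mem_ofPred_eq] at hfst hsnd
  have hsnd' : S.Reachable y d.snd := by
    refine (reachable_left_or_right_of_sup_edge ?_).resolve_left hsnd
    rw [hST, hreach]
    exact ((hfst.mono sdiff_le).mono hle).trans (Adj.reachable (.inl d.adj))
  have hnot : ¬ S.Reachable d.fst d.snd := fun h => hsnd (hfst.trans h)
  have hleH : S ⊔ edge d.fst d.snd ≤ H :=
    sup_le (sdiff_le_iff'.2 hle) ((edge_le_iff _).2 (.inr d.adj))
  have hexchange : (S ⊔ edge d.fst d.snd).Reachable x y :=
    (hfst.mono le_sup_left).trans <| .trans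
      (Adj.reachable (.inr ((edge_adj ..).2 ⟨.inl ⟨rfl, rfl⟩, d.adj.ne⟩)))
      (hsnd'.mono le_sup_left).symm
  refine ⟨d, hd, S ⊔ edge d.fst d.snd, mem_spanningForests_iff.2 ⟨hleH,
    (hacyclic.anti sdiff_le).sup_edge_of_not_reachable hnot, ?_⟩, ?_⟩
  · ext a b
    refine ⟨fun h => h.mono hleH, fun h => ?_⟩
    have hab : T.Reachable a b := hreach ▸ h.mono le_sup_left
    refine reachable_of_forall_adj (fun a b hab => ?_) hab
    rw [← hST] at hab
    rcases hab with hab | hab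
    · exact Adj.reachable (.inl hab)
    · rcases (edge_adj ..).1 hab with ⟨⟨rfl, rfl⟩ | ⟨rfl, rfl⟩, -⟩
      exacts [hexchange, hexchange.symm]
  · rw [((disjoint_edge _).2 fun h => hnot h.reachable).sup_sdiff_cancel_right, hST]

/-- The new trees contain `xy`, and exchanging `xy` for an edge of `p` turns each of them into a
forest of `H`; every forest of `H` is hit at most once for each edge of `p`. -/
theorem tau_sup_edge_le (hH : H.edgeSet.Finite) (p : H.Walk x y) :
    tau (H ⊔ edge x y) ≤ (p.length + 1) * tau H := by
  classical
  let exchange (d : H.Dart) (F : SimpleGraph V) : SimpleGraph V := F \ edge d.fst d.snd ⊔ edge x y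
  have hcover : spanningForests (H ⊔ edge x y) ⊆ spanningForests H ∪
      ⋃ d ∈ p.darts.toFinset, exchange d '' spanningForests H := by
    intro T hT
    by_cases hxy : T.Adj x y
    · obtain ⟨d, hd, hF⟩ := exists_exchange hT hxy p
      exact .inr (Set.mem_iUnion₂.2 ⟨d, List.mem_toFinset.2 hd, hF⟩)
    · rw [mem_spanningForests_iff_maximal] at hT
      left
      rw [mem_spanningForests_iff_maximal]
      exact ⟨⟨((disjoint_edge _).2 hxy).left_le_of_le_sup_right hT.prop.1, hT.prop.2⟩,
        fun F hF => hT.le_of_ge ⟨hF.1.trans le_sup_left, hF.2⟩⟩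
  have hfin := finite_spanningForests hH
  calc tau (H ⊔ edge x y)
      ≤ (spanningForests H ∪ ⋃ d ∈ p.darts.toFinset, exchange d '' spanningForests H).ncard :=
        Set.ncard_le_ncard hcover
          (hfin.union (Set.Finite.biUnion (Finset.finite_toSet _) fun _ _ => hfin.image _))
    _ ≤ tau H + ∑ d ∈ p.darts.toFinset, (exchange d '' spanningForests H).ncard :=
        (Set.ncard_union_le _ _).trans (by gcongr; exacts [le_rfl, Finset.set_ncard_biUnion_le _ _])
    _ ≤ tau H + ∑ _d ∈ p.darts.toFinset, tau H := by
        gcongr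
        exact Set.ncard_image_le hfin
    _ ≤ tau H + p.length * tau H := by
        rw [Finset.sum_const, smul_eq_mul]
        gcongr
        exact (List.toFinset_card_le _).trans p.length_darts.le
    _ = (p.length + 1) * tau H := by ring

theorem exists_walk_below_of_not_isAcyclic {L : Type*} [LinearOrder L] {key : V → L}
    (hkey : key.Injective) (hH : ¬ H.IsAcyclic) :
    ∃ v q r, q ≠ r ∧ H.Adj v q ∧ H.Adj v r ∧
      ∃ p : H.Walk q r, ∀ w ∈ p.support, key w < key v := by
  classical
  simp only [IsAcyclic, not_forall, not_not] at hH
  obtain ⟨a, c₀, hc₀⟩ := hH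
  obtain ⟨v, hv, hmax⟩ := c₀.support.toFinset.exists_max_image key
    ⟨a, List.mem_toFinset.2 c₀.start_mem_support⟩
  rw [List.mem_toFinset] at hv
  obtain ⟨c, hc, hle⟩ : ∃ c : H.Walk v v, c.IsCycle ∧ ∀ w ∈ c.support, key w ≤ key v :=
    ⟨c₀.rotate v hv, hc₀.rotate hv, fun w hw => hmax w <| List.mem_toFinset.2 <| by
      rwa [Walk.mem_support_rotate_iff] at hw⟩
  cases c with
  | nil => exact (hc.ne_nil rfl).elim
  | @cons _ q _ hvq p =>
    have hp : ¬ p.Nil := fun h => hvq.ne h.eq.symm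
    have hpath : (p.dropLast.concat (p.adj_penultimate hp)).IsPath := by
      rw [Walk.concat_dropLast]
      exact ((Walk.cons_isCycle_iff p hvq).1 hc).1
    rw [Walk.concat_isPath_iff] at hpath
    refine ⟨v, q, p.penultimate, ?_, hvq, (p.adj_penultimate hp).symm, p.dropLast,
      fun w hw => ?_⟩
    · simpa [Walk.penultimate_cons_of_not_nil hvq p hp] using hc.snd_ne_penultimate
    · have hmem : w ∈ p.support := by
        rw [← Walk.support_dropLast_concat hp]
        exact List.mem_append_left _ hw
      refine (hle w (.tail _ hmem)).lt_of_ne (hkey.ne ?_)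
      exact ne_of_mem_of_not_mem hw hpath.2

theorem sum_map_darts_sub {A : Type*} [AddCommGroup A] (φ : V → A) (p : H.Walk a b) :
    (p.darts.map fun d => φ d.snd - φ d.fst).sum = φ b - φ a := by
  induction p with
  | nil => simp
  | cons _ p ih => simp [ih]

end SpanningForest

/-! ### Faces of the square lattice -/

section Lattice

theorem squareLattice_adj_iff {p q : ℤ × ℤ} : squareLattice.Adj p q ↔
    p.1 = q.1 ∧ (p.2 = q.2 + 1 ∨ q.2 = p.2 + 1) ∨
      p.2 = q.2 ∧ (p.1 = q.1 + 1 ∨ q.1 = p.1 + 1) := by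
  simp only [squareLattice, abs_eq (zero_le_one' ℤ)]
  omega

theorem squareLattice_adj_iff_eq_add {p q : ℤ × ℤ} : squareLattice.Adj p q ↔
    q = p + (0, 1) ∨ p = q + (0, 1) ∨ q = p + (1, 0) ∨ p = q + (1, 0) := by
  simp only [squareLattice_adj_iff, Prod.ext_iff, Prod.fst_add, Prod.snd_add]
  omega

/-- The boundary of a set `J` of faces, each face being represented by its bottom-left corner: the
edges of the square lattice that have a face of `J` on exactly one side. The faces on the two sides
of the edge `pq` are `p ⊓ q` and `p ⊔ q - 1`. -/
def faceBoundary (J : Set (ℤ × ℤ)) : SimpleGraph (ℤ × ℤ) where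
  Adj p q := squareLattice.Adj p q ∧ ¬ (p ⊓ q ∈ J ↔ p ⊔ q - 1 ∈ J)
  symm := ⟨fun p q h => ⟨h.1.symm, by rw [inf_comm, sup_comm]; exact h.2⟩⟩
  loopless := ⟨fun _ h => h.1.ne rfl⟩

theorem faceBoundary_le (J : Set (ℤ × ℤ)) : faceBoundary J ≤ squareLattice := fun _ _ h => h.1

theorem toPlane_le_toPlane {p q : ℤ × ℤ} : toPlane p ≤ toPlane q ↔ p ≤ q := by
  simp only [toPlane, Int.cast_le, Prod.le_def]

theorem toPlane_sup (p q : ℤ × ℤ) : toPlane (p ⊔ q) = toPlane p ⊔ toPlane q := by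
  simp only [toPlane, Prod.mk_sup_mk, Prod.fst_sup, Prod.snd_sup, Int.cast_max]

theorem toPlane_inf (p q : ℤ × ℤ) : toPlane (p ⊓ q) = toPlane p ⊓ toPlane q := by
  simp only [toPlane, Prod.mk_inf_mk, Prod.fst_inf, Prod.snd_inf, Int.cast_min]

/-- The closed unit square whose bottom-left corner is `f`. -/
def closedCell (f : ℤ × ℤ) : Set (ℝ × ℝ) := Set.Icc (toPlane f) (toPlane (f + 1))

/-- The open unit square whose bottom-left corner is `f`. -/
def cell (f : ℤ × ℤ) : Set (ℝ × ℝ) :=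
  Set.Ioo (f.1 : ℝ) (f.1 + 1) ×ˢ Set.Ioo (f.2 : ℝ) (f.2 + 1)

theorem closedCell_eq_prod (f : ℤ × ℤ) :
    closedCell f = Set.Icc (f.1 : ℝ) (f.1 + 1) ×ˢ Set.Icc (f.2 : ℝ) (f.2 + 1) := by
  simp only [closedCell, toPlane, Set.Icc_prod_eq, Prod.fst_add, Prod.snd_add, Prod.fst_one,
    Prod.snd_one, Int.cast_add, Int.cast_one]

theorem closure_cell (f : ℤ × ℤ) : closure (cell f) = closedCell f := by
  rw [cell, closure_prod_eq, closure_Ioo (by simp), closure_Ioo (by simp), closedCell_eq_prod]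

theorem isPreconnected_cell (f : ℤ × ℤ) : IsPreconnected (cell f) :=
  isPreconnected_Ioo.prod isPreconnected_Ioo

theorem segment_toPlane {p q : ℤ × ℤ} (h : squareLattice.Adj p q) :
    segment ℝ (toPlane p) (toPlane q) = Set.Icc (toPlane (p ⊓ q)) (toPlane (p ⊔ q)) := by
  obtain ⟨a, b⟩ := p
  obtain ⟨c, d⟩ := q
  rw [toPlane_inf, toPlane_sup]
  rcases squareLattice_adj_iff.1 h with ⟨h, -⟩ | ⟨h, -⟩ <;> obtain rfl : _ = _ := h
  · simp only [toPlane, ← Prod.image_mk_segment_right, segment_eq_uIcc, ← Set.singleton_prod,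
      Prod.mk_inf_mk, Prod.mk_sup_mk, Set.Icc_prod_eq, inf_idem, sup_idem, Set.Icc_self, Set.uIcc]
  · simp only [toPlane, ← Prod.image_mk_segment_left, segment_eq_uIcc, ← Set.prod_singleton,
      Prod.mk_inf_mk, Prod.mk_sup_mk, Set.Icc_prod_eq, inf_idem, sup_idem, Set.Icc_self, Set.uIcc]

theorem segment_eq_closedCell_inter {p q : ℤ × ℤ} (h : squareLattice.Adj p q) :
    segment ℝ (toPlane p) (toPlane q) = closedCell (p ⊓ q) ∩ closedCell (p ⊔ q - 1) := by
  rw [segment_toPlane h, closedCell, closedCell, Set.Icc_inter_Icc, ← toPlane_sup, ← toPlane_inf,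
    sub_add_cancel]
  rw [squareLattice_adj_iff] at h
  have hsup : p ⊓ q ⊔ (p ⊔ q - 1) = p ⊓ q := by
    simp only [sup_eq_left, Prod.le_def, Prod.fst_sub, Prod.snd_sub, Prod.fst_sup, Prod.snd_sup,
      Prod.fst_inf, Prod.snd_inf, Prod.fst_one, Prod.snd_one]
    omega
  have hinf : (p ⊓ q + 1) ⊓ (p ⊔ q) = p ⊔ q := by
    simp only [inf_eq_right, Prod.le_def, Prod.fst_add, Prod.snd_add, Prod.fst_sup, Prod.snd_sup,
      Prod.fst_inf, Prod.snd_inf, Prod.fst_one, Prod.snd_one]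
    omega
  rw [hsup, hinf]

theorem midpoint_mem_Icc_toPlane_iff {p q u v : ℤ × ℤ} :
    midpoint ℝ (toPlane p) (toPlane q) ∈ Set.Icc (toPlane u) (toPlane v) ↔
      u + u ≤ p + q ∧ p + q ≤ v + v := by
  have toPlane_add (p q : ℤ × ℤ) : toPlane p + toPlane q = toPlane (p + q) := by
    simp only [toPlane, Prod.mk_add_mk, Prod.fst_add, Prod.snd_add, Int.cast_add]
  rw [midpoint_eq_smul_add, invOf_eq_inv, Set.mem_Icc, le_inv_smul_iff_of_pos two_pos,
    inv_smul_le_iff_of_pos two_pos, two_smul, two_smul, toPlane_add, toPlane_add, toPlane_add,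
    toPlane_le_toPlane, toPlane_le_toPlane]

theorem midpoint_mem_closedCell_inter {p q : ℤ × ℤ} (h : squareLattice.Adj p q) :
    midpoint ℝ (toPlane p) (toPlane q) ∈ closedCell (p ⊓ q) ∩ closedCell (p ⊔ q - 1) :=
  segment_eq_closedCell_inter h ▸ midpoint_mem_segment _ _

theorem eventually_mem_Icc_floor (s : ℝ) :
    ∀ᶠ u in nhds s, s ∈ Set.Icc (⌊u⌋ : ℝ) (⌊u⌋ + 1) := by
  have hceil : ((⌈s⌉ - 1 : ℤ) : ℝ) < s := by
    push_cast
    linarith [Int.ceil_lt_add_one s]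
  filter_upwards [Ioo_mem_nhds hceil (Int.lt_floor_add_one s)] with u hu
  constructor
  · have hfloor : ⌊u⌋ < ⌊s⌋ + 1 := Int.floor_lt.2 (mod_cast hu.2)
    exact Int.le_floor.1 (Int.lt_add_one_iff.1 hfloor)
  · have hfloor : ⌈s⌉ - 1 ≤ ⌊u⌋ := Int.le_floor.2 hu.1.le
    exact_mod_cast Int.ceil_le.1 (sub_le_iff_le_add.1 hfloor)

theorem mem_closedCell_floor (x : ℝ × ℝ) : x ∈ closedCell (⌊x.1⌋, ⌊x.2⌋) := by
  rw [closedCell_eq_prod]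
  exact ⟨⟨Int.floor_le _, (Int.lt_floor_add_one _).le⟩,
    ⟨Int.floor_le _, (Int.lt_floor_add_one _).le⟩⟩

theorem tendsto_toPlane_cofinite :
    Filter.Tendsto toPlane Filter.cofinite (Bornology.cobounded (ℝ × ℝ)) := by
  rw [← Filter.coprod_cofinite, Bornology.cobounded_prod, Metric.cobounded_eq_cocompact]
  exact Filter.Tendsto.prodMap_coprod Int.tendsto_coe_cofinite Int.tendsto_coe_cofinite

theorem exists_adj_common_edge {f g : ℤ × ℤ} (h : squareLattice.Adj f g) :
    ∃ p q, squareLattice.Adj p q ∧ (p ⊓ q = f ∧ p ⊔ q - 1 = g ∨ p ⊓ q = g ∧ p ⊔ q - 1 = f) := by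
  refine ⟨f ⊔ g, f ⊓ g + 1, ?_⟩
  simp only [squareLattice_adj_iff, Prod.ext_iff, Prod.fst_add, Prod.snd_add, Prod.fst_sub,
    Prod.snd_sub, Prod.fst_sup, Prod.snd_sup, Prod.fst_inf, Prod.snd_inf, Prod.fst_one,
    Prod.snd_one] at *
  omega

theorem faceBoundary_adj_up {J : Set (ℤ × ℤ)} {x y : ℤ} :
    (faceBoundary J).Adj (x, y) (x, y + 1) ↔ ¬ ((x, y) ∈ J ↔ (x - 1, y) ∈ J) := by
  have hside : ((x, y + 1) - 1 : ℤ × ℤ) = (x - 1, y) :=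
    Prod.ext rfl (add_sub_cancel_right y 1)
  simp [faceBoundary, squareLattice_adj_iff, hside]

theorem faceBoundary_adj_right {J : Set (ℤ × ℤ)} {x y : ℤ} :
    (faceBoundary J).Adj (x, y) (x + 1, y) ↔ ¬ ((x, y) ∈ J ↔ (x, y - 1) ∈ J) := by
  have hside : ((x + 1, y) - 1 : ℤ × ℤ) = (x, y - 1) :=
    Prod.ext (add_sub_cancel_right x 1) rfl
  simp [faceBoundary, squareLattice_adj_iff, hside]

theorem exists_ne_faceBoundary_adj {J : Set (ℤ × ℤ)} {p q : ℤ × ℤ} (h : (faceBoundary J).Adj p q) :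
    ∃ r ≠ q, (faceBoundary J).Adj p r := by
  obtain ⟨x, y⟩ := p
  have hup := @faceBoundary_adj_up J x y
  have hright := @faceBoundary_adj_right J x y
  have hdown := @faceBoundary_adj_up J x (y - 1)
  have hleft := @faceBoundary_adj_right J (x - 1) y
  rw [sub_add_cancel, adj_comm] at hdown hleft
  by_contra! hne
  have hnup := hne (x, y + 1)
  have hnright := hne (x + 1, y)
  have hndown := hne (x, y - 1)
  have hnleft := hne (x - 1, y)
  have hq : q = (x, y + 1) ∨ q = (x + 1, y) ∨ q = (x, y - 1) ∨ q = (x - 1, y) := by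
    have := squareLattice_adj_iff.1 h.1
    simp only [Prod.ext_iff]
    omega
  rcases hq with rfl | rfl | rfl | rfl <;> grind

theorem exists_faceBoundary_adj {J : Set (ℤ × ℤ)} (hJ : J.Finite) (hne : J.Nonempty) :
    ∃ p q, (faceBoundary J).Adj p q := by
  obtain ⟨⟨x, y⟩, hf, hmax⟩ := J.exists_max_image Prod.snd hJ hne
  have habove : (x, y + 1) ∉ J := fun h => (lt_add_one y).not_ge (hmax _ h)
  refine ⟨(x, y + 1), (x + 1, y + 1), faceBoundary_adj_right.2 ?_⟩
  rw [add_sub_cancel_right]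
  tauto

end Lattice

theorem isBounded_setOf_isBounded_connectedComponentIn_compl {E : Type*} [NormedAddCommGroup E]
    [NormedSpace ℝ E] {K : Set E} (hK : Bornology.IsBounded K) :
    Bornology.IsBounded {x | x ∈ Kᶜ ∧ Bornology.IsBounded (connectedComponentIn Kᶜ x)} := by
  obtain ⟨R, hR, hKR⟩ := hK.subset_closedBall_lt 0 0
  refine (Metric.isBounded_closedBall (x := 0) (r := R)).subset fun x ⟨_, hbdd⟩ => ?_
  by_contra hxR
  rw [mem_closedBall_zero_iff, not_le] at hxR
  have hray : (fun t : ℝ => t • x) '' Set.Ici 1 ⊆ connectedComponentIn Kᶜ x := by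
    refine (isPreconnected_Ici.image _ (by fun_prop)).subset_connectedComponentIn
      ⟨1, Set.self_mem_Ici, one_smul ℝ x⟩ ?_
    rintro _ ⟨t, ht, rfl⟩ htK
    have := mem_closedBall_zero_iff.1 (hKR htK)
    rw [norm_smul, Real.norm_of_nonneg (zero_le_one.trans ht)] at this
    exact (hxR.trans_le (le_mul_of_one_le_left (norm_nonneg x) ht)).not_ge this
  obtain ⟨C, hC⟩ := (hbdd.subset hray).exists_norm_le
  have hxpos : 0 < ‖x‖ := hR.trans hxR
  obtain ⟨n, hn⟩ := exists_nat_gt (max 1 (C / ‖x‖))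
  have hle := hC _ ⟨n, (max_lt_iff.1 hn).1.le, rfl⟩
  rw [norm_smul, Real.norm_natCast] at hle
  exact ((div_lt_iff₀ hxpos).1 (max_lt_iff.1 hn).2).not_ge hle

/-! ### The interior of a loop -/

namespace SimpleClosedLoop

variable {α : SimpleClosedLoop}

instance : NeZero α.length := ⟨(Nat.zero_lt_of_lt α.two_lt_length).ne'⟩

/-- The graph on the lattice points formed by the edges of the loop. -/
def edgeGraph (α : SimpleClosedLoop) : SimpleGraph (ℤ × ℤ) where
  Adj p q := ∃ i, (α.vertex i = p ∧ α.vertex (i + 1) = q) ∨ (α.vertex i = q ∧ α.vertex (i + 1) = p)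
  symm := ⟨fun _ _ ⟨i, h⟩ => ⟨i, h.symm⟩⟩
  loopless := ⟨fun p ⟨i, h⟩ => (α.adj i).ne (by rcases h with h | h <;> rw [h.1, h.2])⟩

/-- The faces interior to the loop, each represented by its bottom-left corner. -/
def interiorFaces (α : SimpleClosedLoop) : Set (ℤ × ℤ) := {f | cell f ⊆ α.interior}

theorem edgeGraph_adj_vertex (i : ZMod α.length) :
    α.edgeGraph.Adj (α.vertex i) (α.vertex (i + 1)) := ⟨i, .inl ⟨rfl, rfl⟩⟩

theorem edgeGraph_le : α.edgeGraph ≤ squareLattice := by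
  rintro p q ⟨i, ⟨rfl, rfl⟩ | ⟨rfl, rfl⟩⟩
  · exact α.adj i
  · exact (α.adj i).symm

theorem segment_subset_trace {p q : ℤ × ℤ} (h : α.edgeGraph.Adj p q) :
    segment ℝ (toPlane p) (toPlane q) ⊆ α.trace := by
  obtain ⟨i, ⟨rfl, rfl⟩ | ⟨rfl, rfl⟩⟩ := h
  · exact Set.subset_iUnion_of_subset i le_rfl
  · rw [segment_symm]
    exact Set.subset_iUnion_of_subset i le_rfl

theorem mem_trace_iff {x : ℝ × ℝ} : x ∈ α.trace ↔
    ∃ p q, α.edgeGraph.Adj p q ∧ x ∈ Set.Icc (toPlane (p ⊓ q)) (toPlane (p ⊔ q)) := by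
  constructor
  · intro hx
    obtain ⟨i, hi⟩ := Set.mem_iUnion.1 hx
    exact ⟨_, _, edgeGraph_adj_vertex i, segment_toPlane (α.adj i) ▸ hi⟩
  · rintro ⟨p, q, hpq, hx⟩
    exact segment_subset_trace hpq (segment_toPlane (edgeGraph_le hpq) ▸ hx)

theorem isCompact_trace : IsCompact α.trace := by
  refine isCompact_iUnion fun i => ?_
  rw [segment_toPlane (α.adj i)]
  exact isCompact_Icc

theorem cell_subset_compl_trace (f : ℤ × ℤ) : cell f ⊆ α.traceᶜ := by
  rintro x ⟨⟨hl, hr⟩, hb, ht⟩ hx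
  obtain ⟨p, q, hpq, ⟨hl', hb'⟩, hr', ht'⟩ := mem_trace_iff.1 hx
  have hadj := squareLattice_adj_iff.1 (edgeGraph_le hpq)
  have h1 := hl'.trans_lt hr
  have h2 := hb'.trans_lt ht
  have h3 := hl.trans_le hr'
  have h4 := hb.trans_le ht'
  simp only [toPlane, Prod.fst_sup, Prod.snd_sup, Prod.fst_inf, Prod.snd_inf] at h1 h2 h3 h4
  norm_cast at h1 h2 h3 h4
  omega

theorem edgeGraph_adj_of_midpoint_mem_trace {p q : ℤ × ℤ} (hpq : squareLattice.Adj p q)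
    (h : midpoint ℝ (toPlane p) (toPlane q) ∈ α.trace) : α.edgeGraph.Adj p q := by
  obtain ⟨r, s, hrs, hmem⟩ := mem_trace_iff.1 h
  have heq : r = p ∧ s = q ∨ r = q ∧ s = p := by
    have hadj := edgeGraph_le hrs
    rw [midpoint_mem_Icc_toPlane_iff] at hmem
    simp only [squareLattice_adj_iff, Prod.le_def, Prod.ext_iff, Prod.fst_add, Prod.snd_add,
      Prod.fst_sup, Prod.snd_sup, Prod.fst_inf, Prod.snd_inf] at *
    omega
  obtain ⟨rfl, rfl⟩ | ⟨rfl, rfl⟩ := heq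
  exacts [hrs, hrs.symm]

theorem mem_interior_iff_of_mem_closedCell {x : ℝ × ℝ} {f : ℤ × ℤ} (hx : x ∉ α.trace)
    (hf : x ∈ closedCell f) : x ∈ α.interior ↔ f ∈ α.interiorFaces := by
  obtain ⟨ε, hε, hball⟩ :=
    Metric.isOpen_iff.1 (isCompact_trace (α := α)).isClosed.isOpen_compl x hx
  obtain ⟨y, hyb, hyc⟩ : (Metric.ball x ε ∩ cell f).Nonempty := by
    rw [← closure_cell] at hf
    exact mem_closure_iff.1 hf _ Metric.isOpen_ball (Metric.mem_ball_self hε)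
  have hU : IsPreconnected (Metric.ball x ε ∪ cell f) :=
    IsPreconnected.union y hyb hyc (convex_ball x ε).isPreconnected (isPreconnected_cell f)
  have hsub := hU.subset_connectedComponentIn (.inl (Metric.mem_ball_self hε))
    (Set.union_subset hball (cell_subset_compl_trace f))
  have heq : ∀ z ∈ cell f, connectedComponentIn α.traceᶜ z = connectedComponentIn α.traceᶜ x :=
    fun z hz => (connectedComponentIn_eq (hsub (.inr hz))).symm
  constructor
  · intro h z hz
    exact ⟨cell_subset_compl_trace f hz, by rw [heq z hz]; exact h.2⟩
  · intro h
    exact ⟨hx, by rw [← heq y hyc]; exact (h hyc).2⟩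

theorem closedCell_subset {f : ℤ × ℤ} (hf : f ∈ α.interiorFaces) :
    closedCell f ⊆ α.trace ∪ α.interior := fun _ hx =>
  or_iff_not_imp_left.2 fun h => (mem_interior_iff_of_mem_closedCell h hx).2 hf

theorem faceBoundary_interiorFaces_le : faceBoundary α.interiorFaces ≤ α.edgeGraph := by
  intro p q h
  by_contra hpq
  have hmid := mt (edgeGraph_adj_of_midpoint_mem_trace h.1) hpq
  obtain ⟨hinf, hsup⟩ := midpoint_mem_closedCell_inter h.1
  exact h.2 ((mem_interior_iff_of_mem_closedCell hmid hinf).symm.trans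
    (mem_interior_iff_of_mem_closedCell hmid hsup))

theorem subgraph_adj_of_edgeGraph_adj {p q : ℤ × ℤ} (h : α.edgeGraph.Adj p q) :
    α.subgraph.Adj p q :=
  ⟨edgeGraph_le h, (segment_subset_trace h).trans Set.subset_union_left⟩

theorem subgraph_adj_of_mem_interiorFaces {p q : ℤ × ℤ} (hpq : squareLattice.Adj p q)
    (h : p ⊓ q ∈ α.interiorFaces ∨ p ⊔ q - 1 ∈ α.interiorFaces) : α.subgraph.Adj p q := by
  refine ⟨hpq, ?_⟩
  rw [segment_eq_closedCell_inter hpq]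
  rcases h with h | h
  · exact Set.inter_subset_left.trans (closedCell_subset h)
  · exact Set.inter_subset_right.trans (closedCell_subset h)

theorem inf_mem_interiorFaces_of_subgraph_adj {p q : ℤ × ℤ} (h : α.subgraph.Adj p q)
    (hpq : ¬ α.edgeGraph.Adj p q) : p ⊓ q ∈ α.interiorFaces := by
  have hmid := mt (edgeGraph_adj_of_midpoint_mem_trace h.1) hpq
  rw [← mem_interior_iff_of_mem_closedCell hmid (midpoint_mem_closedCell_inter h.1).1]
  exact (h.2 (midpoint_mem_segment _ _)).resolve_left hmid

theorem subgraph_verts_finite : α.subgraph.verts.Finite := by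
  have hbdd : Bornology.IsBounded (α.trace ∪ α.interior) :=
    isCompact_trace.isBounded.union
      (isBounded_setOf_isBounded_connectedComponentIn_compl isCompact_trace.isBounded)
  have hmem := tendsto_toPlane_cofinite (Bornology.isBounded_def.1 hbdd)
  exact compl_compl α.subgraph.verts ▸ Filter.mem_cofinite.1 hmem

theorem mem_iff_of_mem_closedCell_of_adj {J : Set (ℤ × ℤ)} (hJ : faceBoundary J ≤ α.edgeGraph)
    {x : ℝ × ℝ} (hx : x ∉ α.trace) {f g : ℤ × ℤ} (hf : x ∈ closedCell f) (hg : x ∈ closedCell g)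
    (hfg : squareLattice.Adj f g) : f ∈ J ↔ g ∈ J := by
  obtain ⟨p, q, hpq, hside⟩ := exists_adj_common_edge hfg
  have hseg : x ∈ segment ℝ (toPlane p) (toPlane q) := by
    rw [segment_eq_closedCell_inter hpq]
    rcases hside with ⟨rfl, rfl⟩ | ⟨rfl, rfl⟩
    exacts [⟨hf, hg⟩, ⟨hg, hf⟩]
  have hiff : p ⊓ q ∈ J ↔ p ⊔ q - 1 ∈ J := by
    by_contra h
    exact hx (segment_subset_trace (hJ ⟨hpq, h⟩) hseg)
  rcases hside with ⟨rfl, rfl⟩ | ⟨rfl, rfl⟩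
  exacts [hiff, hiff.symm]

theorem mem_iff_of_mem_closedCell {J : Set (ℤ × ℤ)} (hJ : faceBoundary J ≤ α.edgeGraph)
    {x : ℝ × ℝ} (hx : x ∉ α.trace) {f g : ℤ × ℤ} (hf : x ∈ closedCell f) (hg : x ∈ closedCell g) :
    f ∈ J ↔ g ∈ J := by
  have hmid : x ∈ closedCell (g.1, f.2) := by
    rw [closedCell_eq_prod] at *
    exact ⟨hg.1, hf.2⟩
  have hle {u v : ℤ × ℤ} (hu : x ∈ closedCell u) (hv : x ∈ closedCell v) : u ≤ v + 1 :=
    toPlane_le_toPlane.1 (hu.1.trans hv.2)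
  have hfg := hle hf hg
  have hgf := hle hg hf
  simp only [Prod.le_def, Prod.fst_add, Prod.snd_add, Prod.fst_one, Prod.snd_one] at hfg hgf
  have hfm : f = (g.1, f.2) ∨ squareLattice.Adj f (g.1, f.2) := by
    simp only [squareLattice_adj_iff, Prod.ext_iff, and_true, true_and]
    omega
  have hmg : (g.1, f.2) = g ∨ squareLattice.Adj (g.1, f.2) g := by
    simp only [squareLattice_adj_iff, Prod.ext_iff, true_and]
    omega
  have hstep {u v : ℤ × ℤ} (hu : x ∈ closedCell u) (hv : x ∈ closedCell v)
      (huv : u = v ∨ squareLattice.Adj u v) : u ∈ J ↔ v ∈ J := by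
    rcases huv with rfl | huv
    exacts [Iff.rfl, mem_iff_of_mem_closedCell_of_adj hJ hx hu hv huv]
  exact (hstep hf hmid hfm).trans (hstep hmid hg hmg)

theorem biUnion_closedCell_mem_nhds {J : Set (ℤ × ℤ)} (hJ : faceBoundary J ≤ α.edgeGraph)
    {x : ℝ × ℝ} (hx : x ∉ α.trace) (hxJ : x ∈ ⋃ f ∈ J, closedCell f) :
    ⋃ f ∈ J, closedCell f ∈ nhds x := by
  obtain ⟨f, hf, hxf⟩ := Set.mem_iUnion₂.1 hxJ
  filter_upwards [(eventually_mem_Icc_floor x.1).prodMk_nhds (eventually_mem_Icc_floor x.2)]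
    with z hz
  have hxz : x ∈ closedCell (⌊z.1⌋, ⌊z.2⌋) := closedCell_eq_prod _ ▸ hz
  exact Set.mem_iUnion₂.2
    ⟨_, (mem_iff_of_mem_closedCell hJ hx hxf hxz).1 hf, mem_closedCell_floor z⟩

theorem subset_interiorFaces {J : Set (ℤ × ℤ)} (hfin : J.Finite)
    (hJ : faceBoundary J ≤ α.edgeGraph) : J ⊆ α.interiorFaces := by
  intro f hf x hx
  have hxt := cell_subset_compl_trace (α := α) f hx
  have hxJ : x ∈ ⋃ f ∈ J, closedCell f :=
    Set.mem_iUnion₂.2 ⟨f, hf, closure_cell f ▸ subset_closure hx⟩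
  have hcompact : IsCompact (⋃ f ∈ J, closedCell f) :=
    hfin.isCompact_biUnion fun f _ => isCompact_Icc
  -- Off the loop, the union of the closed faces of `J` is clopen.
  have hsub : connectedComponentIn α.traceᶜ x ⊆ _root_.interior (⋃ f ∈ J, closedCell f) := by
    refine isPreconnected_connectedComponentIn.subset_left_of_subset_union isOpen_interior
      hcompact.isClosed.isOpen_compl (disjoint_compl_right.mono_left interior_subset) ?_
      ⟨x, mem_connectedComponentIn hxt,
        mem_interior_iff_mem_nhds.2 (biUnion_closedCell_mem_nhds hJ hxt hxJ)⟩
    intro y hy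
    have hyt := connectedComponentIn_subset _ _ hy
    exact or_iff_not_imp_right.2 fun hyJ => mem_interior_iff_mem_nhds.2
      (biUnion_closedCell_mem_nhds hJ hyt (not_not.1 hyJ))
  exact ⟨hxt, hcompact.isBounded.subset (hsub.trans interior_subset)⟩

end SimpleClosedLoop

/-! ### Winding parity of closed walks -/

section Crossing

/-- `1` if the step from `a` to `b` crosses the horizontal ray going right from the centre of the
face `f`, and `0` otherwise. -/
def rayCrossing (f a b : ℤ × ℤ) : ZMod 2 :=
  if a.1 = b.1 ∧ f.1 < a.1 ∧ min a.2 b.2 = f.2 then 1 else 0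

variable {H : SimpleGraph (ℤ × ℤ)}

/-- The parity of the number of crossings of a walk with the horizontal ray going right from the
centre of the face `f`. For a closed walk, this is its winding number around `f` modulo `2`. -/
def crossing (f : ℤ × ℤ) {a b : ℤ × ℤ} (p : H.Walk a b) : ZMod 2 :=
  (p.darts.map fun d => rayCrossing f d.fst d.snd).sum

theorem crossing_append (f : ℤ × ℤ) {a b c : ℤ × ℤ} (p : H.Walk a b) (q : H.Walk b c) :
    crossing f (p.append q) = crossing f p + crossing f q := by
  simp only [crossing, Walk.darts_append, List.map_append, List.sum_append]

theorem crossing_cons (f : ℤ × ℤ) {a b c : ℤ × ℤ} (h : H.Adj a b) (p : H.Walk b c) :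
    crossing f (.cons h p) = rayCrossing f a b + crossing f p := by
  simp only [crossing, Walk.darts_cons, List.map_cons, List.sum_cons]

theorem crossing_eq_zero {f a b : ℤ × ℤ} {p : H.Walk a b}
    (h : ∀ d ∈ p.darts, rayCrossing f d.fst d.snd = 0) : crossing f p = 0 :=
  List.sum_eq_zero (List.forall_mem_map.2 h)

theorem crossing_eq_of_not_adj_up (hH : H ≤ squareLattice) {x y : ℤ}
    (h : ¬ H.Adj (x, y) (x, y + 1)) {a b : ℤ × ℤ} (p : H.Walk a b) :
    crossing (x, y) p = crossing (x - 1, y) p := by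
  refine congrArg List.sum (List.map_congr_left fun d _ => if_congr ?_ rfl rfl)
  obtain ⟨⟨⟨a₁, a₂⟩, b₁, b₂⟩, hd⟩ := d
  have hadj := squareLattice_adj_iff.1 (hH hd)
  have hsymm := hd.symm
  grind

theorem crossing_eq_of_not_adj_right (hH : H ≤ squareLattice) {x y : ℤ}
    (h : ¬ H.Adj (x, y) (x + 1, y)) {a : ℤ × ℤ} (p : H.Walk a a) :
    crossing (x, y) p = crossing (x, y - 1) p := by
  -- The rays from the two faces only differ by the part of the line at height `y` right of `x`.
  let φ (a : ℤ × ℤ) : ZMod 2 := if a.2 = y ∧ x < a.1 then 1 else 0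
  have hφ (d : H.Dart) : rayCrossing (x, y) d.fst d.snd =
      rayCrossing (x, y - 1) d.fst d.snd + (φ d.snd - φ d.fst) := by
    obtain ⟨⟨⟨a₁, a₂⟩, b₁, b₂⟩, hd⟩ := d
    have hadj := squareLattice_adj_iff.1 (hH hd)
    have hsymm := hd.symm
    have : (-1 : ZMod 2) = 1 := rfl
    grind [rayCrossing]
  simp only [crossing, hφ, List.sum_map_add, sum_map_darts_sub, sub_self, add_zero]

theorem faceBoundary_crossing_le (hH : H ≤ squareLattice) {a : ℤ × ℤ} (p : H.Walk a a) :
    faceBoundary {f | crossing f p = 1} ≤ H := by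
  have hup (x y : ℤ) (h : (faceBoundary {f | crossing f p = 1}).Adj (x, y) (x, y + 1)) :
      H.Adj (x, y) (x, y + 1) := by
    by_contra hxy
    rw [faceBoundary_adj_up, Set.mem_ofPred_eq, Set.mem_ofPred_eq,
      crossing_eq_of_not_adj_up hH hxy] at h
    exact h Iff.rfl
  have hright (x y : ℤ) (h : (faceBoundary {f | crossing f p = 1}).Adj (x, y) (x + 1, y)) :
      H.Adj (x, y) (x + 1, y) := by
    by_contra hxy
    rw [faceBoundary_adj_right, Set.mem_ofPred_eq, Set.mem_ofPred_eq,
      crossing_eq_of_not_adj_right hH hxy] at h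
    exact h Iff.rfl
  rintro ⟨q₁, q₂⟩ ⟨r₁, r₂⟩ h
  have hadj := squareLattice_adj_iff.1 (faceBoundary_le _ h)
  grind [SimpleGraph.adj_comm]

theorem finite_setOf_crossing_eq_one (hH : H ≤ squareLattice) {a : ℤ × ℤ} (p : H.Walk a a) :
    {f | crossing f p = 1}.Finite := by
  obtain ⟨l, hl⟩ := (List.finite_toSet p.support).bddBelow
  obtain ⟨u, hu⟩ := (List.finite_toSet p.support).bddAbove
  refine (Set.finite_Icc l u).subset fun f hf => ?_
  by_contra hout
  refine zero_ne_one (α := ZMod 2) (Eq.trans ?_ hf)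
  have hmem (d : H.Dart) (hd : d ∈ p.darts) : l ≤ d.fst ∧ l ≤ d.snd ∧ d.fst ≤ u ∧ d.snd ≤ u :=
    have hfst := p.dart_fst_mem_support_of_mem_darts hd
    have hsnd := p.dart_snd_mem_support_of_mem_darts hd
    ⟨hl hfst, hl hsnd, hu hfst, hu hsnd⟩
  simp only [Prod.le_def] at hmem
  rw [Set.mem_Icc, Prod.le_def, Prod.le_def] at hout
  by_cases hleft : f.1 < l.1
  · -- The ray meets every edge joining the half-planes above and below it.
    let φ (a : ℤ × ℤ) : ZMod 2 := if f.2 < a.2 then 1 else 0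
    have hφ (d : H.Dart) (hd : d ∈ p.darts) : rayCrossing f d.fst d.snd = φ d.snd - φ d.fst := by
      have : (-1 : ZMod 2) = 1 := rfl
      grind [rayCrossing, squareLattice_adj_iff.1 (hH d.adj)]
    rw [crossing, List.map_congr_left hφ, sum_map_darts_sub, sub_self]
  · refine (crossing_eq_zero fun d hd => if_neg ?_).symm
    have := hmem d hd
    omega

end Crossing

namespace SimpleClosedLoop

variable {α : SimpleClosedLoop}

theorem mem_interiorFaces_of_crossing {c f : ℤ × ℤ} {p : α.subgraph.spanningCoe.Walk c c}
    (hf : crossing f p = 1) : f ∈ α.interiorFaces := by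
  have hle : α.subgraph.spanningCoe ≤ squareLattice := α.subgraph.spanningCoe_le
  by_contra hfI
  refine hfI (subset_interiorFaces (J := {f | crossing f p = 1} \ α.interiorFaces)
    ((finite_setOf_crossing_eq_one hle p).subset Set.sdiff_subset) ?_ ⟨hf, hfI⟩)
  rintro q r ⟨hqr, hne⟩
  by_contra hedge
  have hI : q ⊓ r ∈ α.interiorFaces ↔ q ⊔ r - 1 ∈ α.interiorFaces :=
    not_not.1 fun h => hedge (faceBoundary_interiorFaces_le ⟨hqr, h⟩)
  have hW : q ⊓ r ∉ α.interiorFaces → (q ⊓ r ∈ {f | crossing f p = 1} ↔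
      q ⊔ r - 1 ∈ {f | crossing f p = 1}) := fun h => not_not.1 fun h' =>
    h (inf_mem_interiorFaces_of_subgraph_adj (faceBoundary_crossing_le hle p ⟨hqr, h'⟩) hedge)
  rw [Set.mem_sdiff, Set.mem_sdiff] at hne
  tauto

end SimpleClosedLoop

section PageOrder

/-- The words-on-a-page order on lattice points, as a lexicographic order. -/
def pageKey (p : ℤ × ℤ) : ℤ ×ₗ ℤ := toLex (-p.2, p.1)

theorem precedes_iff {p q : ℤ × ℤ} : Precedes p q ↔ pageKey p < pageKey q := by
  simp only [Precedes, pageKey, Prod.Lex.toLex_lt_toLex, neg_lt_neg_iff, neg_inj]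

theorem pageKey_injective : pageKey.Injective := by
  intro p q h
  obtain ⟨hsnd, hfst⟩ := Prod.ext_iff.1 (toLex.injective h)
  exact Prod.ext hfst (neg_injective hsnd)

theorem eq_or_eq_of_adj_of_precedes {v q : ℤ × ℤ} (h : squareLattice.Adj v q)
    (hq : Precedes q v) : q = (v.1 - 1, v.2) ∨ q = (v.1, v.2 + 1) := by
  simp only [squareLattice_adj_iff, Precedes, Prod.ext_iff] at *
  omega

theorem box_le_iff {G : squareLattice.Subgraph} {x y : ℤ} : box (x, y) ≤ G ↔
    G.Adj (x - 1, y) (x, y) ∧ G.Adj (x - 1, y + 1) (x, y + 1) ∧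
      G.Adj (x - 1, y) (x - 1, y + 1) ∧ G.Adj (x, y) (x, y + 1) := by
  constructor
  · intro h
    refine ⟨h.2 ⟨?_, ?_, ?_⟩, h.2 ⟨?_, ?_, ?_⟩, h.2 ⟨?_, ?_, ?_⟩, h.2 ⟨?_, ?_, ?_⟩⟩ <;>
      simp [squareLattice_adj_iff]
  · rintro ⟨hbottom, htop, hleft, hright⟩
    refine ⟨?_, ?_⟩
    · rintro _ (rfl | rfl | rfl | rfl)
      exacts [hbottom.snd_mem, htop.snd_mem, htop.fst_mem, hbottom.fst_mem]
    · rintro p q ⟨hp, hq, hpq⟩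
      rw [Subgraph.top_adj, squareLattice_adj_iff] at hpq
      have := G.adj_comm
      grind

end PageOrder

namespace SimpleClosedLoop

variable {α : SimpleClosedLoop}

theorem interiorFaces_subset_verts : α.interiorFaces ⊆ α.subgraph.verts := fun _ hf =>
  closedCell_subset hf ⟨le_rfl, toPlane_le_toPlane.2 (le_add_of_nonneg_right zero_le_one)⟩

theorem interiorFaces_finite : α.interiorFaces.Finite :=
  subgraph_verts_finite.subset interiorFaces_subset_verts

/-- The closed walk through `v` and `p` crosses the ray going right from the face to the left of
`v` only once, just above `v`. -/
theorem mem_interiorFaces_of_walk {v q r : ℤ × ℤ} (hqr : q ≠ r)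
    (hq : α.subgraph.spanningCoe.Adj v q) (hr : α.subgraph.spanningCoe.Adj v r)
    (p : α.subgraph.spanningCoe.Walk q r)
    (hp : ∀ w ∈ p.support, Precedes w v) : (v.1 - 1, v.2) ∈ α.interiorFaces := by
  have hle : α.subgraph.spanningCoe ≤ squareLattice := α.subgraph.spanningCoe_le
  have hq' := eq_or_eq_of_adj_of_precedes (hle hq) (hp q p.start_mem_support)
  have hr' := eq_or_eq_of_adj_of_precedes (hle hr) (hp r p.end_mem_support)
  wlog hleft : q = (v.1 - 1, v.2) generalizing q r
  · exact this hqr.symm hr hq p.reverse (by simpa only [Walk.support_reverse, List.mem_reverse])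
      hr' hq' (by grind)
  have hup : r = (v.1, v.2 + 1) := hr'.resolve_left fun h => hqr (hleft.trans h.symm)
  have hpath : crossing (v.1 - 1, v.2) p = 0 := by
    refine crossing_eq_zero fun d hd => if_neg ?_
    have hfst := hp _ (p.dart_fst_mem_support_of_mem_darts hd)
    have hsnd := hp _ (p.dart_snd_mem_support_of_mem_darts hd)
    simp only [Precedes] at hfst hsnd
    omega
  subst hleft hup
  have hleft_edge : rayCrossing (v.1 - 1, v.2) v (v.1 - 1, v.2) = 0 :=
    if_neg (by dsimp only; omega)
  have hup_edge : rayCrossing (v.1 - 1, v.2) (v.1, v.2 + 1) v = 1 :=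
    if_pos (by dsimp only; omega)
  refine mem_interiorFaces_of_crossing (p := .cons hq (p.append (.cons hr.symm .nil))) ?_
  rw [crossing_cons, crossing_append, crossing_cons, hpath, hleft_edge, hup_edge]
  rfl

theorem box_le_subgraph_iff {v : ℤ × ℤ} :
    box v ≤ α.subgraph ↔ (v.1 - 1, v.2) ∈ α.interiorFaces := by
  obtain ⟨x, y⟩ := v
  rw [box_le_iff]
  constructor
  · simp only [← Subgraph.spanningCoe_adj]
    rintro ⟨hbottom, htop, hleft, hright⟩
    refine mem_interiorFaces_of_walk (v := (x, y)) (by simp) hbottom.symm hright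
      (.cons hleft (.cons htop .nil)) ?_
    simp [Precedes]
  · intro h
    have hface : (x, y + 1) - 1 = (x - 1, y) := Prod.ext rfl (add_sub_cancel_right y 1)
    refine ⟨?_, ?_, ?_, ?_⟩ <;> apply subgraph_adj_of_mem_interiorFaces <;>
      simp [squareLattice_adj_iff, hface, h]

theorem vertex_induction {P : ZMod α.length → Prop} (h : ∀ i, P i → P (i + 1))
    {i : ZMod α.length} (hi : P i) (j : ZMod α.length) : P j := by
  have hadd (n : ℕ) : P (i + n) := by
    induction n with
    | zero => simpa using hi
    | succ n ih => simpa [add_assoc] using h _ ih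
  simpa using hadd (j - i).val

theorem cycleGraph_isContained_edgeGraph : cycleGraph α.length ⊑ α.edgeGraph := by
  obtain ⟨n, hn, vertex, hinj, hadj⟩ := α
  obtain ⟨n, rfl⟩ := Nat.exists_eq_add_of_le' hn
  refine ⟨⟨⟨vertex, fun {i j} hij => ?_⟩, hinj⟩⟩
  rcases hij with h | h
  · exact ⟨j, .inr ⟨rfl, congrArg vertex (sub_eq_iff_eq_add'.1 h).symm⟩⟩
  · exact ⟨i, .inl ⟨rfl, congrArg vertex (sub_eq_iff_eq_add'.1 h).symm⟩⟩

theorem not_isAcyclic_edgeGraph : ¬ α.edgeGraph.IsAcyclic := fun h =>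
  isAcyclic_iff_free_cycleGraph.1 h _ α.two_lt_length cycleGraph_isContained_edgeGraph

theorem edgeGraph_le_subgraph : α.edgeGraph ≤ α.subgraph.spanningCoe :=
  fun _ _ => subgraph_adj_of_edgeGraph_adj

theorem interiorFaces_nonempty : α.interiorFaces.Nonempty := by
  have hle : α.edgeGraph ≤ α.subgraph.spanningCoe := edgeGraph_le_subgraph
  obtain ⟨v, q, r, hqr, hq, hr, p, hp⟩ :=
    exists_walk_below_of_not_isAcyclic pageKey_injective (not_isAcyclic_edgeGraph (α := α))
  refine ⟨_, mem_interiorFaces_of_walk hqr (hle hq) (hle hr) (p.mapLe hle) fun w hw => ?_⟩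
  exact precedes_iff.2 (hp w (by simpa using hw))

theorem eq_or_eq_of_edgeGraph_adj {i : ZMod α.length} {q : ℤ × ℤ}
    (h : α.edgeGraph.Adj (α.vertex (i + 1)) q) : q = α.vertex i ∨ q = α.vertex (i + 1 + 1) := by
  obtain ⟨j, ⟨hj, rfl⟩ | ⟨rfl, hj⟩⟩ := h
  · rw [α.injective hj]
    exact .inr rfl
  · rw [add_right_cancel (α.injective hj)]
    exact .inl rfl

theorem faceBoundary_interiorFaces : faceBoundary α.interiorFaces = α.edgeGraph := by
  refine faceBoundary_interiorFaces_le.antisymm ?_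
  have hstep (i : ZMod α.length)
      (h : (faceBoundary α.interiorFaces).Adj (α.vertex i) (α.vertex (i + 1))) :
      (faceBoundary α.interiorFaces).Adj (α.vertex (i + 1)) (α.vertex (i + 1 + 1)) := by
    obtain ⟨r, hr, hadj⟩ := exists_ne_faceBoundary_adj h.symm
    rwa [← (eq_or_eq_of_edgeGraph_adj (faceBoundary_interiorFaces_le hadj)).resolve_left hr]
  obtain ⟨p, q, hpq⟩ :=
    exists_faceBoundary_adj interiorFaces_finite (interiorFaces_nonempty (α := α))
  obtain ⟨i, hi⟩ : ∃ i, (faceBoundary α.interiorFaces).Adj (α.vertex i) (α.vertex (i + 1)) := by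
    obtain ⟨i, ⟨rfl, rfl⟩ | ⟨rfl, rfl⟩⟩ := faceBoundary_interiorFaces_le hpq
    exacts [⟨i, hpq⟩, ⟨i, hpq.symm⟩]
  rintro _ _ ⟨j, ⟨rfl, rfl⟩ | ⟨rfl, rfl⟩⟩
  · exact vertex_induction hstep hi j
  · exact (vertex_induction hstep hi j).symm

theorem subgraph_adj_iff {p q : ℤ × ℤ} : α.subgraph.Adj p q ↔
    squareLattice.Adj p q ∧ (p ⊓ q ∈ α.interiorFaces ∨ p ⊔ q - 1 ∈ α.interiorFaces) := by
  refine ⟨fun h => ⟨h.adj_sub, ?_⟩, fun h => subgraph_adj_of_mem_interiorFaces h.1 h.2⟩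
  by_cases hpq : α.edgeGraph.Adj p q
  · rw [← faceBoundary_interiorFaces] at hpq
    have := hpq.2
    tauto
  · exact .inl (inf_mem_interiorFaces_of_subgraph_adj h hpq)

end SimpleClosedLoop

/-! ### The number of vertices -/

section EdgeCount

theorem two_mul_ncard_union {β : Type*} {X Y : Set β} (hX : X.Finite) (hY : Y.Finite) :
    2 * (X ∪ Y).ncard = X.ncard + Y.ncard + (X ∆ Y).ncard := by
  have hadd := Set.ncard_union_add_ncard_inter X Y hX hY
  have hdiff := Set.ncard_sdiff_add_ncard_of_subset
    (Set.inter_subset_left.trans Set.subset_union_left : X ∩ Y ⊆ X ∪ Y) (hX.union hY)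
  have hsymm : X ∆ Y = (X ∪ Y) \ (X ∩ Y) := symmDiff_eq_sup_sdiff_inf X Y
  rw [hsymm]
  omega

/-- The edges of `H` pointing in the direction `d`, each given by its initial point. -/
def edgesAlong (H : SimpleGraph (ℤ × ℤ)) (d : ℤ × ℤ) : Set (ℤ × ℤ) := {p | H.Adj p (p + d)}

theorem ncard_edgeSet {H : SimpleGraph (ℤ × ℤ)} (hH : H ≤ squareLattice)
    (hfin : H.edgeSet.Finite) :
    H.edgeSet.ncard = (edgesAlong H (0, 1)).ncard + (edgesAlong H (1, 0)).ncard := by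
  let edgeAlong (d p : ℤ × ℤ) : Sym2 (ℤ × ℤ) := s(p, p + d)
  have hedges : H.edgeSet =
      edgeAlong (0, 1) '' edgesAlong H (0, 1) ∪ edgeAlong (1, 0) '' edgesAlong H (1, 0) := by
    refine Set.Subset.antisymm (fun e => ?_) (Set.union_subset ?_ ?_)
    · induction e with | _ p q => ?_
      intro (h : H.Adj p q)
      obtain rfl | rfl | rfl | rfl := squareLattice_adj_iff_eq_add.1 (hH h)
      · exact .inl ⟨p, h, rfl⟩
      · exact .inl ⟨q, h.symm, Sym2.eq_swap⟩
      · exact .inr ⟨p, h, rfl⟩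
      · exact .inr ⟨q, h.symm, Sym2.eq_swap⟩
    all_goals exact Set.image_subset_iff.2 fun p hp => hp
  have hinj (d : ℤ × ℤ) (hd : 0 ≤ d) : Function.Injective (edgeAlong d) := by
    intro p q h
    simp only [edgeAlong, Sym2.eq_iff, Prod.ext_iff, Prod.fst_add, Prod.snd_add] at h ⊢
    have := hd.1
    have := hd.2
    dsimp only [Prod.fst_zero, Prod.snd_zero] at *
    omega
  have hdisj : Disjoint (edgeAlong (0, 1) '' edgesAlong H (0, 1))
      (edgeAlong (1, 0) '' edgesAlong H (1, 0)) := by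
    rw [Set.disjoint_left]
    rintro _ ⟨p, -, rfl⟩ ⟨q, -, h⟩
    simp only [edgeAlong, Sym2.eq_iff, Prod.ext_iff, Prod.fst_add, Prod.snd_add] at h
    omega
  rw [hedges, Set.finite_union] at hfin
  rw [hedges, Set.ncard_union_eq hdisj hfin.1 hfin.2,
    Set.ncard_image_of_injective _ (hinj _ (by decide)),
    Set.ncard_image_of_injective _ (hinj _ (by decide))]

end EdgeCount

namespace SimpleClosedLoop

variable {α : SimpleClosedLoop}

theorem ncard_vertices : α.vertices.ncard = α.length := by
  rw [vertices, ← Set.image_univ, Set.ncard_image_of_injective _ α.injective, Set.ncard_univ,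
    Nat.card_zmod]

theorem ncard_edgeSet_edgeGraph : α.edgeGraph.edgeSet.ncard = α.length := by
  have hedges : α.edgeGraph.edgeSet =
      (fun i => s(α.vertex i, α.vertex (i + 1))) '' Set.univ := by
    ext e
    induction e with | _ p q => ?_
    simp only [mem_edgeSet, Set.image_univ, Set.mem_range, Sym2.eq_iff]
    rfl
  have htwo : (2 : ZMod α.length) ≠ 0 := fun h =>
    absurd (Nat.le_of_dvd two_pos ((ZMod.natCast_eq_zero_iff 2 _).1 (by exact_mod_cast h)))
      (not_le.2 α.two_lt_length)
  rw [hedges, Set.ncard_image_of_injective, Set.ncard_univ, Nat.card_zmod]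
  intro i j h
  rcases Sym2.eq_iff.1 h with ⟨h, -⟩ | ⟨hij, hji⟩
  · exact α.injective h
  · exact (htwo (by linear_combination α.injective hji - α.injective hij)).elim

theorem two_mul_ncard_edgesAlong {d : ℤ × ℤ} (hd : 0 ≤ d) (hadj : squareLattice.Adj 0 d) :
    2 * (edgesAlong α.subgraph.spanningCoe d).ncard =
      2 * α.interiorFaces.ncard + (edgesAlong α.edgeGraph d).ncard := by
  have hlattice (p : ℤ × ℤ) : squareLattice.Adj p (p + d) := by
    simp only [squareLattice_adj_iff, Prod.fst_add, Prod.snd_add, Prod.fst_zero,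
      Prod.snd_zero] at hadj ⊢
    omega
  have hinf (p : ℤ × ℤ) : p ⊓ (p + d) = p := inf_eq_left.2 (le_add_of_nonneg_right hd)
  have hsup (p : ℤ × ℤ) : p ⊔ (p + d) = p + d := sup_eq_right.2 (le_add_of_nonneg_right hd)
  have hshift (p : ℤ × ℤ) :
      p ∈ (· + (1 - d)) '' α.interiorFaces ↔ p + d - 1 ∈ α.interiorFaces := by
    rw [Set.image_add_right, Set.mem_preimage, neg_sub, ← add_sub_assoc]
  have hsubgraph : edgesAlong α.subgraph.spanningCoe d =
      α.interiorFaces ∪ (· + (1 - d)) '' α.interiorFaces := by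
    ext p
    rw [Set.mem_union, hshift, edgesAlong, Set.mem_ofPred_eq, Subgraph.spanningCoe_adj,
      subgraph_adj_iff, hinf, hsup, and_iff_right (hlattice p)]
  have hloop : edgesAlong α.edgeGraph d =
      α.interiorFaces ∆ ((· + (1 - d)) '' α.interiorFaces) := by
    ext p
    rw [Set.mem_symmDiff, hshift, edgesAlong, Set.mem_ofPred_eq, ← faceBoundary_interiorFaces]
    change squareLattice.Adj _ _ ∧ _ ↔ _
    rw [hinf, hsup, and_iff_right (hlattice p)]
    tauto
  have hfin := interiorFaces_finite (α := α)
  rw [hsubgraph, hloop, two_mul_ncard_union hfin (hfin.image _),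
    Set.ncard_image_of_injective _ (add_left_injective _)]
  ring

/-- Count the sides of the interior faces: an edge of the loop is a side of exactly one interior
face, and every other edge of the grid graph is a side of two. -/
theorem two_mul_ncard_edgeSet :
    2 * α.subgraph.spanningCoe.edgeSet.ncard = 4 * α.interiorFaces.ncard + α.length := by
  have hfin := finite_edgeSet_spanningCoe (subgraph_verts_finite (α := α))
  have hup := two_mul_ncard_edgesAlong (α := α) (d := (0, 1)) (by decide)
    (squareLattice_adj_iff.2 (by decide))
  have hright := two_mul_ncard_edgesAlong (α := α) (d := (1, 0)) (by decide)
    (squareLattice_adj_iff.2 (by decide))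
  have hloop := ncard_edgeSet α.edgeGraph_le (hfin.subset (edgeSet_mono edgeGraph_le_subgraph))
  rw [ncard_edgeSet α.subgraph.spanningCoe_le hfin]
  rw [ncard_edgeSet_edgeGraph] at hloop
  omega

variable (α) in
/-- The bottom edges of the interior faces of the loop. -/
def bottomEdges : Set (Sym2 (ℤ × ℤ)) := (fun f => s(f, f + (1, 0))) '' α.interiorFaces

variable (α) in
/-- A spanning tree of the simple grid graph bounded by the loop: the bottom edge of each interior
face is deleted. -/
def combGraph : SimpleGraph (ℤ × ℤ) := α.subgraph.spanningCoe.deleteEdges α.bottomEdges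

theorem ncard_bottomEdges : α.bottomEdges.ncard = α.interiorFaces.ncard := by
  refine Set.ncard_image_of_injective _ fun f g h => ?_
  simp only [Sym2.eq_iff, Prod.ext_iff, Prod.fst_add, Prod.snd_add] at h ⊢
  omega

theorem bottomEdges_subset : α.bottomEdges ⊆ α.subgraph.spanningCoe.edgeSet := by
  rintro _ ⟨f, hf, rfl⟩
  have hinf : f ⊓ (f + (1, 0)) = f := inf_eq_left.2 (le_add_of_nonneg_right (by decide))
  exact subgraph_adj_iff.2 ⟨squareLattice_adj_iff.2 (by simp), .inl (by rwa [hinf])⟩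

theorem ncard_edgeSet_combGraph :
    α.combGraph.edgeSet.ncard + α.interiorFaces.ncard = α.subgraph.spanningCoe.edgeSet.ncard := by
  rw [combGraph, edgeSet_deleteEdges, ← ncard_bottomEdges]
  exact Set.ncard_sdiff_add_ncard_of_subset bottomEdges_subset
    (finite_edgeSet_spanningCoe subgraph_verts_finite)

/-- In a cycle, the two neighbours of its last vertex `v` are the points to the left of `v` and
above `v`. The face between them is interior, so the edge to the left of `v` was deleted. -/
theorem isAcyclic_combGraph : α.combGraph.IsAcyclic := by
  by_contra hcyclic
  have hle : α.combGraph ≤ α.subgraph.spanningCoe := deleteEdges_le _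
  have hlattice : α.combGraph ≤ squareLattice := hle.trans α.subgraph.spanningCoe_le
  obtain ⟨v, q, r, hqr, hq, hr, p, hp⟩ :=
    exists_walk_below_of_not_isAcyclic pageKey_injective hcyclic
  have hprec : ∀ w ∈ p.support, Precedes w v := fun w hw => precedes_iff.2 (hp w hw)
  have hface := mem_interiorFaces_of_walk hqr (hle hq) (hle hr) (p.mapLe hle)
    fun w hw => hprec w (by simpa using hw)
  have hdeleted : ¬ α.combGraph.Adj v (v.1 - 1, v.2) := fun h =>
    (deleteEdges_adj.1 h).2 ⟨_, hface, by simp [Sym2.eq_swap]⟩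
  have hq' := (eq_or_eq_of_adj_of_precedes (hlattice hq)
    (hprec q p.start_mem_support)).resolve_left fun h => hdeleted (h ▸ hq)
  have hr' := (eq_or_eq_of_adj_of_precedes (hlattice hr)
    (hprec r p.end_mem_support)).resolve_left fun h => hdeleted (h ▸ hr)
  exact hqr (hq'.trans hr'.symm)

theorem reachable_combGraph_of_notMem {p : ℤ × ℤ} (h : α.subgraph.Adj p (p + (1, 0)))
    (hp : p ∉ α.interiorFaces) : α.combGraph.Reachable p (p + (1, 0)) := by
  refine Adj.reachable (deleteEdges_adj.2 ⟨h, ?_⟩)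
  rintro ⟨f, hf, hedge⟩
  simp only [Sym2.eq_iff, Prod.ext_iff, Prod.fst_add, Prod.snd_add] at hedge
  exact hp (by rwa [← (Prod.ext (by omega) (by omega) : f = p)])

theorem reachable_combGraph_up {p : ℤ × ℤ} (h : α.subgraph.Adj p (p + (0, 1))) :
    α.combGraph.Reachable p (p + (0, 1)) := by
  refine Adj.reachable (deleteEdges_adj.2 ⟨h, ?_⟩)
  rintro ⟨f, -, hedge⟩
  simp only [Sym2.eq_iff, Prod.ext_iff, Prod.fst_add, Prod.snd_add] at hedge
  omega

/-- A deleted bottom edge is bypassed along the other three sides of its face, after bypassing the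
top side if necessary; this stops since a highest edge of the grid graph is not deleted. -/
theorem reachable_combGraph_right {p : ℤ × ℤ} (h : α.subgraph.Adj p (p + (1, 0))) :
    α.combGraph.Reachable p (p + (1, 0)) := by
  by_contra hp
  obtain ⟨f, ⟨hf, hf'⟩, hmax⟩ := Set.exists_max_image
    {f | α.subgraph.Adj f (f + (1, 0)) ∧ ¬ α.combGraph.Reachable f (f + (1, 0))} Prod.snd
    (subgraph_verts_finite.subset fun _ hf => hf.1.fst_mem) ⟨p, h, hp⟩
  have hface : f ∈ α.interiorFaces := not_imp_comm.1 (reachable_combGraph_of_notMem hf) hf'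
  have hbox := box_le_subgraph_iff (v := f + (1, 0)).2 (by simpa using hface)
  obtain ⟨x, y⟩ := f
  obtain ⟨-, htop, hleft, hright⟩ := box_le_iff.1 hbox
  simp only [add_sub_cancel_right, add_zero] at htop hleft hright
  have htop' : α.combGraph.Reachable (x, y + 1) (x + 1, y + 1) := by
    have hreach : α.combGraph.Reachable (x, y + 1) ((x, y + 1) + (1, 0)) := by
      by_contra h
      exact absurd (hmax (x, y + 1) ⟨by simpa using htop, h⟩) (by simp)
    simpa using hreach
  have hleft' := reachable_combGraph_up (p := (x, y)) (by simpa using hleft)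
  have hright' := reachable_combGraph_up (p := (x + 1, y)) (by simpa using hright)
  simp only [Prod.mk_add_mk, add_zero] at hleft' hright' hf'
  exact hf' ((hleft'.trans htop').trans hright'.symm)

theorem combGraph_mem_spanningForests :
    α.combGraph ∈ spanningForests α.subgraph.spanningCoe := by
  have hle : α.combGraph ≤ α.subgraph.spanningCoe := deleteEdges_le _
  refine mem_spanningForests_iff.2 ⟨hle, isAcyclic_combGraph, ?_⟩
  ext p q
  refine ⟨fun h => h.mono hle, reachable_of_forall_adj fun p q h => ?_⟩
  obtain rfl | rfl | rfl | rfl :=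
    squareLattice_adj_iff_eq_add.1 (α.subgraph.spanningCoe_le h)
  · exact reachable_combGraph_up h
  · exact (reachable_combGraph_up h.symm).symm
  · exact reachable_combGraph_right h
  · exact (reachable_combGraph_right h.symm).symm

/-- A form of Pick's theorem. -/
theorem two_mul_ncard_verts (hG : α.subgraph.Connected) :
    2 * α.subgraph.verts.ncard = 2 * α.area + α.vertices.ncard + 2 := by
  have htree := ncard_edgeSet_add_one_of_mem_spanningForests hG subgraph_verts_finite
    combGraph_mem_spanningForests
  have hcomb := ncard_edgeSet_combGraph (α := α)
  have hedges := two_mul_ncard_edgeSet (α := α)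
  have harea : α.area = α.interiorFaces.ncard := rfl
  rw [harea, ncard_vertices]
  omega

theorem mem_verts_of_mem_interiorFaces {v : ℤ × ℤ} (hv : (v.1 - 1, v.2) ∈ α.interiorFaces) :
    v ∈ α.subgraph.verts :=
  (box_le_subgraph_iff.2 hv).1 (Set.mem_insert _ _)

theorem verts_sdiff_topLeftBoundary :
    α.subgraph.verts \ topLeftBoundary α.subgraph = (· + (1, 0)) '' α.interiorFaces := by
  ext v
  have hface : v ∈ (· + ((1, 0) : ℤ × ℤ)) '' α.interiorFaces ↔
      (v.1 - 1, v.2) ∈ α.interiorFaces := by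
    rw [Set.image_add_right, Set.mem_preimage, ← sub_eq_add_neg]
    simp [Prod.sub_def]
  rw [hface, topLeftBoundary, Set.mem_sdiff, Set.mem_sep_iff, box_le_subgraph_iff]
  have := mem_verts_of_mem_interiorFaces (α := α) (v := v)
  tauto

theorem ncard_verts_sdiff_topLeftBoundary :
    (α.subgraph.verts \ topLeftBoundary α.subgraph).ncard = α.area := by
  rw [verts_sdiff_topLeftBoundary, Set.ncard_image_of_injective _ (add_left_injective _)]
  rfl

theorem ncard_verts_eq_add_ncard_topLeftBoundary :
    α.subgraph.verts.ncard = α.area + (topLeftBoundary α.subgraph).ncard := by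
  have hsubset : topLeftBoundary α.subgraph ⊆ α.subgraph.verts := Set.sep_subset _ _
  rw [← ncard_verts_sdiff_topLeftBoundary,
    Set.ncard_sdiff_add_ncard_of_subset hsubset subgraph_verts_finite]

end SimpleClosedLoop

/-! ### Multipliers -/

section Multiplier

variable {G : squareLattice.Subgraph} {v : ℤ × ℤ}

theorem uptoGraph_spanningCoe : (uptoGraph G v).spanningCoe =
    (priorGraph G v).spanningCoe ⊔ G.spanningCoe ⊓ edge v (v.1 - 1, v.2) ⊔
      G.spanningCoe ⊓ edge v (v.1, v.2 + 1) := by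
  have hedge (r : ℤ × ℤ) (hr : Precedes r v) :
      G.spanningCoe ⊓ edge v r ≤ (uptoGraph G v).spanningCoe := by
    rintro p q ⟨hpq, h⟩
    obtain ⟨⟨rfl, rfl⟩ | ⟨rfl, rfl⟩, -⟩ := (edge_adj ..).1 h
    · exact ⟨⟨hpq.fst_mem, .inr rfl⟩, ⟨hpq.snd_mem, .inl hr⟩, hpq⟩
    · exact ⟨⟨hpq.fst_mem, .inl hr⟩, ⟨hpq.snd_mem, .inr rfl⟩, hpq⟩
  refine le_antisymm ?_ (sup_le (sup_le ?_ (hedge _ ?_)) (hedge _ ?_))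
  · rintro p q ⟨⟨hp, hp' | rfl⟩, ⟨hq, hq' | rfl⟩, hpq⟩
    · exact .inl (.inl ⟨⟨hp, hp'⟩, ⟨hq, hq'⟩, hpq⟩)
    · obtain rfl | rfl := eq_or_eq_of_adj_of_precedes hpq.symm.adj_sub hp'
      · exact .inl (.inr ⟨hpq, (edge_adj ..).2 ⟨.inr ⟨rfl, rfl⟩, hpq.ne⟩⟩)
      · exact .inr ⟨hpq, (edge_adj ..).2 ⟨.inr ⟨rfl, rfl⟩, hpq.ne⟩⟩
    · obtain rfl | rfl := eq_or_eq_of_adj_of_precedes hpq.adj_sub hq'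
      · exact .inl (.inr ⟨hpq, (edge_adj ..).2 ⟨.inl ⟨rfl, rfl⟩, hpq.ne⟩⟩)
      · exact .inr ⟨hpq, (edge_adj ..).2 ⟨.inl ⟨rfl, rfl⟩, hpq.ne⟩⟩
    · exact (hpq.ne rfl).elim
  · exact fun p q h => ⟨⟨h.1.1, .inl h.1.2⟩, ⟨h.2.1.1, .inl h.2.1.2⟩, h.2.2⟩
  · exact .inr ⟨rfl, sub_one_lt _⟩
  · exact .inl (lt_add_one _)

theorem not_reachable_priorGraph {q : ℤ × ℤ} (hq : v ≠ q) :
    ¬ (priorGraph G v).spanningCoe.Reachable v q := by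
  rintro ⟨p⟩
  cases p with
  | nil => exact hq rfl
  | cons h p =>
    have hself : Precedes v v := h.1.2
    exact lt_irrefl _ (precedes_iff.1 hself)

theorem tau_priorGraph_sup_inf_edge_left {K : SimpleGraph (ℤ × ℤ)} :
    tau ((priorGraph G v).spanningCoe ⊔ K ⊓ edge v (v.1 - 1, v.2)) =
      tau (priorGraph G v).spanningCoe :=
  tau_sup_inf_edge fun _ => not_reachable_priorGraph fun h =>
    (sub_one_lt v.1).ne (congrArg Prod.fst h).symm

theorem tau_uptoGraph_le (hG : G.verts.Finite) (hv : box v ≤ G) :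
    tau (uptoGraph G v).coe ≤ 4 * tau (priorGraph G v).coe := by
  obtain ⟨x, y⟩ := v
  obtain ⟨hbottom, htop, hleft, hright⟩ := box_le_iff.1 hv
  set P := (priorGraph G (x, y)).spanningCoe with hP
  set H := P ⊔ G.spanningCoe ⊓ edge (x, y) (x - 1, y) with hH
  have hH_fin : H.edgeSet.Finite := by
    refine (finite_edgeSet_spanningCoe hG).subset (edgeSet_mono (sup_le ?_ inf_le_left))
    exact fun _ _ h => h.2.2
  have hstart : H.Adj (x, y) (x - 1, y) :=
    .inr ⟨hbottom.symm, (edge_adj ..).2 ⟨.inl ⟨rfl, rfl⟩, hbottom.ne.symm⟩⟩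
  have hleft' : H.Adj (x - 1, y) (x - 1, y + 1) :=
    .inl ⟨⟨hleft.fst_mem, by simp [Precedes]⟩, ⟨hleft.snd_mem, by simp [Precedes]⟩, hleft⟩
  have htop' : H.Adj (x - 1, y + 1) (x, y + 1) :=
    .inl ⟨⟨htop.fst_mem, by simp [Precedes]⟩, ⟨htop.snd_mem, by simp [Precedes]⟩, htop⟩
  have hedge : edge (x, y) (x, y + 1) ≤ G.spanningCoe := (edge_le_iff _).2 (.inr hright)
  calc tau (uptoGraph G (x, y)).coe
      = tau (H ⊔ edge (x, y) (x, y + 1)) := by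
        rw [tau_coe, uptoGraph_spanningCoe, inf_eq_right.2 hedge]
    _ ≤ 4 * tau H := tau_sup_edge_le hH_fin (.cons hstart (.cons hleft' (.cons htop' .nil)))
    _ = 4 * tau (priorGraph G (x, y)).coe := by
        rw [hH, hP, tau_priorGraph_sup_inf_edge_left, tau_coe]

theorem tau_uptoGraph_eq (h : G.Adj v (v.1 - 1, v.2) → G.Adj v (v.1, v.2 + 1) →
      ¬ (priorGraph G v).spanningCoe.Reachable (v.1 - 1, v.2) (v.1, v.2 + 1)) :
    tau (uptoGraph G v).coe = tau (priorGraph G v).coe := by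
  have hup : ¬ (priorGraph G v).spanningCoe.Reachable v (v.1, v.2 + 1) :=
    not_reachable_priorGraph (by simp [Prod.ext_iff])
  rw [tau_coe, uptoGraph_spanningCoe, tau_sup_inf_edge, tau_priorGraph_sup_inf_edge_left, tau_coe]
  intro hv hreach
  by_cases hleft : G.spanningCoe.Adj v (v.1 - 1, v.2)
  · exact (reachable_left_or_right_of_sup_edge (hreach.mono (sup_le_sup_left inf_le_right _))).elim
      hup (h hleft hv)
  · rw [((disjoint_edge _).2 hleft).eq_bot, sup_bot_eq] at hreach
    exact hup hreach

theorem tau_priorGraph_pos (hG : G.verts.Finite) : 0 < tau (priorGraph G v).coe := by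
  rw [tau_coe]
  exact tau_pos (finite_edgeSet_spanningCoe (hG.subset fun _ h => h.1))

theorem multiplier_le_four (hG : G.verts.Finite) (hv : box v ≤ G) : multiplier G v ≤ 4 :=
  div_le_of_le_mul₀ (Nat.cast_nonneg _) zero_le_four (mod_cast tau_uptoGraph_le hG hv)

theorem uptoGraph_eq_induce_insert (hv : v ∈ G.verts) :
    uptoGraph G v = G.induce (insert v {w ∈ G.verts | Precedes w v}) := by
  rw [uptoGraph]
  congr 1
  ext w
  rw [Set.mem_insert_iff, Set.mem_ofPred_eq, Set.mem_ofPred_eq, and_or_left, or_comm]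
  exact or_congr_left (and_iff_right_of_imp fun h => h ▸ hv)

theorem tau_le_pow {B : Set (ℤ × ℤ)} {k : ℕ} (hG : G.verts.Finite)
    (hle : ∀ v ∈ G.verts, v ∉ B → tau (uptoGraph G v).coe ≤ k * tau (priorGraph G v).coe)
    (heq : ∀ v ∈ B, tau (uptoGraph G v).coe = tau (priorGraph G v).coe) :
    tau G.coe ≤ k ^ (G.verts \ B).ncard := by
  suffices hinduce : ∀ s : Finset (ℤ × ℤ), ↑s ⊆ G.verts →
      (∀ p ∈ s, ∀ q ∈ G.verts, Precedes q p → q ∈ s) →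
      tau (G.induce s).coe ≤ k ^ (↑s \ B : Set (ℤ × ℤ)).ncard by
    have hverts := hinduce hG.toFinset (by simp) (by simp +contextual)
    rwa [hG.coe_toFinset, Subgraph.induce_self_verts] at hverts
  intro s
  induction s using Finset.induction_on_max_value pageKey with
  | empty =>
    intro _ _
    rw [tau_coe, Finset.coe_empty, Subgraph.induce_empty, Subgraph.spanningCoe_bot, tau_bot]
    simp
  | insert v s hv hmax ih =>
    intro hs hlower
    rw [Finset.coe_insert, Set.insert_subset_iff] at hs
    have hprec : ∀ w ∈ s, Precedes w v := fun w hw => precedes_iff.2 <|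
      (hmax w hw).lt_of_ne fun h => hv (pageKey_injective h ▸ hw)
    have hmem {w : ℤ × ℤ} (hw : w ∈ G.verts) (hwv : Precedes w v) : w ∈ s :=
      Finset.mem_of_mem_insert_of_ne (hlower v (Finset.mem_insert_self v s) w hw hwv)
        fun h => (precedes_iff.1 (h ▸ hwv)).false
    have hprior : (s : Set (ℤ × ℤ)) = {w ∈ G.verts | Precedes w v} :=
      Set.ext fun w => ⟨fun hw => ⟨hs.2 hw, hprec w hw⟩, fun hw => hmem hw.1 hw.2⟩
    have hs' : tau (priorGraph G v).coe ≤ k ^ (↑s \ B : Set (ℤ × ℤ)).ncard := by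
      rw [priorGraph, ← hprior]
      refine ih hs.2 fun p hp q hq hqp => hmem hq ?_
      exact precedes_iff.2 ((precedes_iff.1 hqp).trans (precedes_iff.1 (hprec p hp)))
    have hupto : G.induce (insert v (s : Set (ℤ × ℤ))) = uptoGraph G v := by
      rw [hprior, uptoGraph_eq_induce_insert hs.1]
    rw [Finset.coe_insert, hupto]
    by_cases hvB : v ∈ B
    · rwa [Set.insert_sdiff_of_mem _ hvB, heq v hvB]
    · rw [Set.insert_sdiff_of_notMem _ hvB, Set.ncard_insert_of_notMem (fun h => hv h.1)
        s.finite_toSet.sdiff, pow_succ']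
      exact (hle v hs.1 hvB).trans (Nat.mul_le_mul_left k hs')

end Multiplier

namespace SimpleClosedLoop

variable {α : SimpleClosedLoop} {v : ℤ × ℤ}

theorem not_reachable_priorGraph_of_notMem (hv : (v.1 - 1, v.2) ∉ α.interiorFaces)
    (hleft : α.subgraph.Adj v (v.1 - 1, v.2)) (hup : α.subgraph.Adj v (v.1, v.2 + 1)) :
    ¬ (priorGraph α.subgraph v).spanningCoe.Reachable (v.1 - 1, v.2) (v.1, v.2 + 1) := by
  rintro ⟨p⟩
  have hne : (v.1 - 1, v.2) ≠ (v.1, v.2 + 1) := fun h =>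
    (sub_one_lt v.1).ne (congrArg Prod.fst h)
  have hle : (priorGraph α.subgraph v).spanningCoe ≤ α.subgraph.spanningCoe := fun _ _ h => h.2.2
  refine hv (mem_interiorFaces_of_walk hne hleft hup (p.mapLe hle) fun w hw => ?_)
  obtain ⟨q, hwq⟩ := mem_support_of_mem_walk_support p (Walk.not_nil_of_ne hne) (by simpa using hw)
  exact hwq.1.2

theorem tau_uptoGraph_eq_of_mem_topLeftBoundary (hv : v ∈ topLeftBoundary α.subgraph) :
    tau (uptoGraph α.subgraph v).coe = tau (priorGraph α.subgraph v).coe :=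
  tau_uptoGraph_eq (not_reachable_priorGraph_of_notMem fun h => hv.2 (box_le_subgraph_iff.2 h))

theorem multiplier_eq_one (hv : v ∈ topLeftBoundary α.subgraph) :
    multiplier α.subgraph v = 1 := by
  rw [multiplier, tau_uptoGraph_eq_of_mem_topLeftBoundary hv, div_self]
  exact Nat.cast_ne_zero.2 (tau_priorGraph_pos subgraph_verts_finite).ne'

theorem tau_subgraph_le : tau α.subgraph.coe ≤ 4 ^ α.area := by
  rw [← ncard_verts_sdiff_topLeftBoundary]
  exact tau_le_pow subgraph_verts_finite
    (fun v hv hv' => tau_uptoGraph_le subgraph_verts_finite (by_contra fun h => hv' ⟨hv, h⟩))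
    fun v => tau_uptoGraph_eq_of_mem_topLeftBoundary

end SimpleClosedLoop

end GridGraph

theorem proposition6p1 (G : GridGraph.squareLattice.Subgraph) (hG : GridGraph.IsGridGraph G)
    (α : GridGraph.SimpleClosedLoop) (hα : G = α.subgraph) :
    (∀ v ∈ G.verts, v ∉ GridGraph.topLeftBoundary G → GridGraph.multiplier G v ≤ 4) ∧
    (∀ v ∈ GridGraph.topLeftBoundary G, GridGraph.multiplier G v = 1) ∧
    (∃ m : ℕ,
      GridGraph.tau G.coe ≤ 4 ^ m ∧
      m = α.area ∧
      (m : ℝ) = (G.verts.ncard : ℝ) - (α.vertices.ncard : ℝ) / 2 - 1 ∧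
      (m : ℝ) = (G.verts.ncard : ℝ) - ((GridGraph.topLeftBoundary G).ncard : ℝ)) := by
  subst hα
  refine ⟨fun v hv hv' => GridGraph.multiplier_le_four hG.1 (by_contra fun h => hv' ⟨hv, h⟩),
    fun v => GridGraph.SimpleClosedLoop.multiplier_eq_one, α.area,
    GridGraph.SimpleClosedLoop.tau_subgraph_le, rfl, ?_, ?_⟩
  · have hpick : 2 * (α.subgraph.verts.ncard : ℝ) = 2 * α.area + α.vertices.ncard + 2 :=
      mod_cast GridGraph.SimpleClosedLoop.two_mul_ncard_verts hG.2
    linarith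
  · have hcard : (α.subgraph.verts.ncard : ℝ) =
        α.area + (GridGraph.topLeftBoundary α.subgraph).ncard :=
      mod_cast GridGraph.SimpleClosedLoop.ncard_verts_eq_add_ncard_topLeftBoundary
    linarith
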